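/- **Definitions.** A metric space is geodesic if any two points $x,y$ are joined by a minimal geodesic (a distance-preserving curve $[0,d(x,y)]\to X$ from $x$ to $y$); $B(x_0,r)$ is the closed ball. For pointed extended metric spaces (distances in $[0,\infty]$) write $(X,x_0)\precsim(Y,y_0)$ if for any $x_1,\dots,x_N\in X$ there are points $y_{i,k}\in Y$ ($0\le i\le N$, $k\ge1$) with $y_{0,k}=y_0$ and $d_X(x_i,x_j)\le\liminf_{k\to\infty}d_Y(y_{i,k},y_{j,k})$ for all $i,j=0,\dots,N$; write $(X,x_0)\sim(Y,y_0)$ if $(X,x_0)\precsim(Y,y_0)\precsim(X,x_0)$. The pointed Gromov–Hausdorff distance of two pointed compact metric spaces is the infimum of $d_H(\varphi(X),\psi(Y))\vee d_Z(\varphi(x_0),\psi(y_0))$ over all isometric embeddings $\varphi:X\to Z$, $\psi:Y\to Z$ into compact metric spaces $Z$. Let $\mathcal P_{(X,x_0)}$ be the family of (isometry classes of) pointed compact metric spaces $(K,k_0)$ with $(K,k_0)\precsim(X,x_0)$, and $\mathcal H_0(N,D)$ the family of pointed metric spaces with at most $N$ points and diameter at most $D$. Put $$\rho\big((X,x_0),(Y,y_0)\big)=\sum_{N=1}^\infty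 2^{-N}\,d_H\big(\mathcal P_{(X,x_0)}\cap\mathcal H_0(N,N),\ \mathcal P_{(Y,y_0)}\cap\mathcal H_0(N,N)\big),$$ where $d_H$ is the Hausdorff distance with respect to the pointed Gromov–Hausdorff distance. For pointed geodesic metric spaces put $$\rho_0\big((X,x_0),(Y,y_0)\big)=\int_{(0,\infty)}\rho\big((r^{-1}B(x_0,r),x_0),(r^{-1}B(y_0,r),y_0)\big)\,r e^{-r^2}\,dr,$$ where $tZ$ denotes $Z$ with its metric multiplied by $t$. Pointed metric spaces are strongly equivalent, $(X,x_0)\simeq(Y,y_0)$, if $(B(x_0,r),x_0)\sim(B(y_0,r),y_0)$ for every $r>0$. Let $\mathcal G_0$ be the family of isometry classes of pointed geodesic metric spaces, and $\mathcal{PG}_0$ that of pointed proper geodesic metric spaces with the topology of pointed Gromov–Hausdorff convergence: $(X_n,x_n)\to(Y,y)$ if for all $r,\varepsilon>0$ and all large $n$ there is a map $f$ from the open $r$-ball about $x_n$ to $Y$ with $f(x_n)=y$ that changes distances by less than $\varepsilon$ and such that the $\varepsilon$-neighbourhood of its image contains the open $(r-\varepsilon)$-ball about $y$. **Theorem.**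 The integrand in the definition of $\rho_0$ is integrable, and: 1. $\rho_0$ induces a metric on $\mathcal G_0/\!\simeq$ (in particular $\rho_0$ is a pseudometric on $\mathcal G_0$ that vanishes exactly on strongly equivalent pairs), and $(\mathcal G_0/\!\simeq,\rho_0)$ is a compact metric space. 2. The natural projection $\mathcal{PG}_0\to\mathcal G_0/\!\simeq$ is a topological embedding; moreover, for pointed proper geodesic metric spaces $(X_n,x_n)$, $n\ge1$, and $(Y,y)$, one has $(X_n,x_n)\to(Y,y)$ in the pointed Gromov–Hausdorff sense if and only if $\rho_0((X_n,x_n),(Y,y))\to0$. 3. If $(X_n,x_n)$, $n\ge1$, and $(Y,y)$ are pointed geodesic metric spaces with $\rho_0((X_n,x_n),(Y,y))\to0$, then for every non-principal ultrafilter $\omega$ on the positive integers the pointed ultralimit of $(X_n,x_n)$ along $\omega$ (the sequences of points $a_n\in X_n$ with $d(a_n,x_n)$ bounded, with the distance $\omega\text{-}\lim d(a_n,b_n)$, sequences at distance $0$ identified) is a geodesic space strongly equivalent to $(Y,y)$. -/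

import Mathlib

open Set Filter Topology MeasureTheory
open scoped ENNReal

universe u v w

noncomputable section

/-! ## Pointed spaces -/

/-- A pointed extended metric space: the distance `edist` takes values in `[0, ∞]`. -/
structure PointedExtMetricSpace : Type (u + 1) where
  carrier : Type u
  [str : EMetricSpace carrier]
  pt : carrier

namespace PointedExtMetricSpace

instance : CoeSort PointedExtMetricSpace.{u} (Type u) := ⟨carrier⟩

instance (X : PointedExtMetricSpace.{u}) : EMetricSpace X := X.str

end PointedExtMetricSpace

/-- A pointed metric space. -/
structure PointedMetricSpace : Type (u + 1) where
  carrier : Type u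
  [str : MetricSpace carrier]
  pt : carrier

namespace PointedMetricSpace

instance : CoeSort PointedMetricSpace.{u} (Type u) := ⟨carrier⟩

instance (X : PointedMetricSpace.{u}) : MetricSpace X := X.str

/-- A pointed metric space, seen as a pointed extended metric space. -/
def toExt (X : PointedMetricSpace.{u}) : PointedExtMetricSpace.{u} where
  carrier := X
  pt := X.pt

end PointedMetricSpace

/-- A metric space is geodesic if any two points `x`, `y` are joined by a minimal geodesic, that is
by a curve `γ : [0, dist x y] → X` from `x` to `y` that preserves distances. -/
def IsGeodesicSpace (X : Type u) [MetricSpace X] : Prop :=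
  ∀ x y : X, ∃ γ : ℝ → X, γ 0 = x ∧ γ (dist x y) = y ∧
    ∀ s ∈ Icc 0 (dist x y), ∀ t ∈ Icc 0 (dist x y), dist (γ s) (γ t) = |s - t|

/-- A pointed geodesic metric space. -/
structure PointedGeodesicSpace : Type (u + 1) extends PointedMetricSpace.{u} where
  geodesic : IsGeodesicSpace toPointedMetricSpace

/-- A pointed proper geodesic metric space. -/
structure PointedProperGeodesicSpace : Type (u + 1) extends PointedGeodesicSpace.{u} where
  proper : ProperSpace toPointedMetricSpace

/-- A pointed compact metric space. Compact metric spaces have at most continuum many points, so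
that every one of them is isometric to one in `Type`. -/
structure PointedCompactSpace : Type 1 extends PointedMetricSpace.{0} where
  compact : CompactSpace toPointedMetricSpace

/-! ## The relations `≾` and `∼` -/

/-- The preorder `(X, x₀) ≾ (Y, y₀)`: for any finite family of points `x 0 = x₀, x 1, …, x N` of
`X` there are points `y i k` of `Y` with `y 0 k = y₀` and
`d (x i) (x j) ≤ liminf_k d (y i k) (y j k)`. -/
def Precsim (X : PointedExtMetricSpace.{u}) (Y : PointedExtMetricSpace.{v}) : Prop :=
  ∀ (N : ℕ) (x : Fin (N + 1) → X), x 0 = X.pt →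
    ∃ y : Fin (N + 1) → ℕ → Y, (∀ k, y 0 k = Y.pt) ∧
      ∀ i j, edist (x i) (x j) ≤ liminf (fun k => edist (y i k) (y j k)) atTop

/-- The equivalence `(X, x₀) ∼ (Y, y₀)`. -/
def Equivalent (X : PointedExtMetricSpace.{u}) (Y : PointedExtMetricSpace.{v}) : Prop :=
  Precsim X Y ∧ Precsim Y X

theorem Precsim.of_isometry {X : PointedExtMetricSpace.{u}} {Y : PointedExtMetricSpace.{v}}
    (f : X → Y) (hf : Isometry f) (h0 : f X.pt = Y.pt) : Precsim X Y := by
  intro N x hx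
  refine ⟨fun i _ => f (x i), fun _ => by simp only [hx, h0], fun i j => ?_⟩
  simp [hf.edist_eq]

theorem Precsim.refl (X : PointedExtMetricSpace.{u}) : Precsim X X :=
  Precsim.of_isometry id isometry_id rfl

theorem Precsim.trans {X : PointedExtMetricSpace.{u}} {Y : PointedExtMetricSpace.{v}}
    {Z : PointedExtMetricSpace.{w}} (h₁ : Precsim X Y) (h₂ : Precsim Y Z) : Precsim X Z := by
  intro N x hx
  obtain ⟨y, hy0, hy⟩ := h₁ N x hx
  choose z hz0 hz using fun k : ℕ => h₂ N (fun i => y i k) (hy0 k)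
  have key : ∀ k : ℕ, ∃ l : ℕ, ∀ i j,
      min (edist (y i k) (y j k) - ((k : ℝ≥0∞) + 1)⁻¹) k ≤ edist (z k i l) (z k j l) := by
    intro k
    have : ∀ᶠ l in atTop, ∀ i j,
        min (edist (y i k) (y j k) - ((k : ℝ≥0∞) + 1)⁻¹) k ≤ edist (z k i l) (z k j l) := by
      rw [eventually_all]
      intro i
      rw [eventually_all]
      intro j
      rcases eq_or_ne (edist (y i k) (y j k)) 0 with h | h
      · simp [h]
      · have hlt : min (edist (y i k) (y j k) - ((k : ℝ≥0∞) + 1)⁻¹) k < edist (y i k) (y j k) := by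
          rcases eq_or_ne (edist (y i k) (y j k)) ∞ with h' | h'
          · rw [h']
            exact lt_of_le_of_lt (min_le_right _ _) (ENNReal.natCast_lt_top k)
          · refine lt_of_le_of_lt (min_le_left _ _) (ENNReal.sub_lt_self h' h ?_)
            simp
        exact (eventually_lt_of_lt_liminf (hlt.trans_le (hz k i j))).mono fun _ h => h.le
    exact this.exists
  choose l hl using key
  refine ⟨fun i k => z k i (l k), fun k => hz0 k _, fun i j => ?_⟩
  refine le_of_forall_lt fun c hc => ?_
  obtain ⟨d, hcd, hd⟩ := exists_between hc
  obtain ⟨e, hde, he⟩ := exists_between hd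
  refine lt_of_lt_of_le hcd (le_liminf_of_le (by isBoundedDefault) ?_)
  have h1 : ∀ᶠ k in atTop, e < edist (y i k) (y j k) :=
    eventually_lt_of_lt_liminf (he.trans_le (hy i j))
  have h2 : ∀ᶠ k : ℕ in atTop, d ≤ (k : ℝ≥0∞) :=
    (ENNReal.tendsto_nat_nhds_top.eventually (lt_mem_nhds (lt_top_of_lt hde))).mono
      fun _ h => h.le
  have h3 : ∀ᶠ k : ℕ in atTop, ((k : ℝ≥0∞) + 1)⁻¹ < e - d := by
    have : Tendsto (fun k : ℕ => ((k : ℝ≥0∞) + 1)⁻¹) atTop (𝓝 0) := by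
      have := (tendsto_add_atTop_iff_nat 1).2 ENNReal.tendsto_inv_nat_nhds_zero
      simpa using this
    exact this.eventually (gt_mem_nhds (tsub_pos_of_lt hde))
  filter_upwards [h1, h2, h3] with k hk1 hk2 hk3
  refine le_trans (le_min ?_ hk2) (hl k i j)
  have hdt : d ≠ ∞ := (lt_top_of_lt hde).ne
  refine ENNReal.le_sub_of_add_le_right (by simp) ?_
  calc d + ((k : ℝ≥0∞) + 1)⁻¹ ≤ d + (e - d) := by gcongr
    _ = e := add_tsub_cancel_of_le hde.le
    _ ≤ _ := hk1.le

/-! ## The pointed Gromov-Hausdorff distance and the pseudometric `ρ` -/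

/-- The pointed Gromov-Hausdorff distance of two pointed compact metric spaces: the infimum of
`d_H (φ X) (ψ Y) ∨ d_Z (φ x₀) (ψ y₀)` over all isometric embeddings `φ`, `ψ` into a compact metric
space `Z`. -/
def pointedGHDist (X Y : PointedCompactSpace) : ℝ≥0∞ :=
  ⨅ (Z : Type) (_ : MetricSpace Z) (_ : CompactSpace Z)
    (φ : X.toPointedMetricSpace → Z) (ψ : Y.toPointedMetricSpace → Z)
    (_ : Isometry φ) (_ : Isometry ψ),
    Metric.hausdorffEDist (range φ) (range ψ) ⊔ edist (φ X.pt) (ψ Y.pt)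

/-- The Hausdorff distance of two families of pointed compact metric spaces, with respect to the
pointed Gromov-Hausdorff distance. -/
def familyHausdorffDist (A B : Set PointedCompactSpace) : ℝ≥0∞ :=
  (⨆ X ∈ A, ⨅ Y ∈ B, pointedGHDist X Y) ⊔ (⨆ Y ∈ B, ⨅ X ∈ A, pointedGHDist X Y)

/-- The pyramid `𝒫_(X, x₀)` of all pointed compact metric spaces that are `≾ (X, x₀)`. -/
def pyramid (X : PointedExtMetricSpace.{u}) : Set PointedCompactSpace :=
  {K | Precsim K.toExt X}

/-- The family `ℋ₀(N, D)` of pointed metric spaces of at most `N` points and of diameter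
at most `D`. -/
def finiteFamily (N : ℕ) (D : ℝ) : Set PointedCompactSpace :=
  {K | ENat.card K.toPointedMetricSpace ≤ N ∧ ∀ x y : K.toPointedMetricSpace, dist x y ≤ D}

/-- The pseudometric `ρ_N`. -/
def rhoN (N : ℕ) (X : PointedExtMetricSpace.{u}) (Y : PointedExtMetricSpace.{v}) : ℝ≥0∞ :=
  familyHausdorffDist (pyramid X ∩ finiteFamily N N) (pyramid Y ∩ finiteFamily N N)

/-- The pseudometric `ρ = ∑_{N ≥ 1} 2^{-N} ρ_N` on pointed extended metric spaces. -/
def rho (X : PointedExtMetricSpace.{u}) (Y : PointedExtMetricSpace.{v}) : ℝ≥0∞ :=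
  ∑' N : ℕ, (2⁻¹ : ℝ≥0∞) ^ (N + 1) * rhoN (N + 1) X Y

/-! ## Rescaled balls and the pseudometric `ρ₀` -/

/-- The space `t X`: the metric of `X` is multiplied by `t > 0`. -/
def PointedExtMetricSpace.rescale (t : ℝ) (ht : 0 < t) (X : PointedExtMetricSpace.{u}) :
    PointedExtMetricSpace.{u} where
  carrier := X
  str :=
    { edist := fun x y => ENNReal.ofReal t * edist x y
      edist_self := fun x => by simp
      edist_comm := fun x y => by simp only [edist_comm]
      edist_triangle := fun x y z => by
        rw [← mul_add]
        gcongr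
        exact edist_triangle x y z
      eq_of_edist_eq_zero := fun {x y} h => by
        rcases mul_eq_zero.1 h with h | h
        · exact absurd (ENNReal.ofReal_eq_zero.1 h) (not_le.2 ht)
        · exact eq_of_edist_eq_zero h }
  pt := X.pt

/-- The closed ball `(B(x₀, r), x₀)` with the restricted metric. -/
def PointedMetricSpace.ball (X : PointedMetricSpace.{u}) (r : ℝ) (hr : 0 < r) :
    PointedExtMetricSpace.{u} where
  carrier := Metric.closedBall X.pt r
  pt := ⟨X.pt, Metric.mem_closedBall_self hr.le⟩

/-- The rescaled closed ball `(r⁻¹ B(x₀, r), x₀)`. -/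
def PointedMetricSpace.rescaledBall (X : PointedMetricSpace.{u}) (r : ℝ) (hr : 0 < r) :
    PointedExtMetricSpace.{u} :=
  (X.ball r hr).rescale r⁻¹ (inv_pos.2 hr)

/-- The integrand `ρ (r⁻¹ B(x₀, r)) (r⁻¹ B(y₀, r)) r exp (-r²)` of `ρ₀`, for `r > 0`. -/
def rho0Integrand (X Y : PointedGeodesicSpace.{u}) (r : ℝ) : ℝ :=
  if hr : 0 < r then
    (rho (X.rescaledBall r hr) (Y.rescaledBall r hr)).toReal * (r * Real.exp (-r ^ 2))
  else 0

/-- The pseudometric `ρ₀`, the integral of `ρ (r⁻¹ B(x₀, r)) (r⁻¹ B(y₀, r)) r exp (-r²)` over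
`(0, ∞)`. -/
def rho0 (X Y : PointedGeodesicSpace.{u}) : ℝ :=
  ∫ r in Ioi (0 : ℝ), rho0Integrand X Y r

/-! ## Strong equivalence and the quotient space -/

/-- Strong equivalence `(X, x₀) ≃ (Y, y₀)`: the closed balls `(B(x₀, r), x₀)` and `(B(y₀, r), y₀)`
are equivalent for every `r > 0`. -/
def StronglyEquivalent (X : PointedMetricSpace.{u}) (Y : PointedMetricSpace.{v}) : Prop :=
  ∀ (r : ℝ) (hr : 0 < r), Equivalent (X.ball r hr) (Y.ball r hr)

/-- Strong equivalence as an equivalence relation on pointed geodesic metric spaces. -/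
def strongSetoid : Setoid PointedGeodesicSpace.{u} where
  r X Y := StronglyEquivalent X.toPointedMetricSpace Y.toPointedMetricSpace
  iseqv :=
    { refl := fun _ _ _ => ⟨Precsim.refl _, Precsim.refl _⟩
      symm := fun h r hr => ⟨(h r hr).2, (h r hr).1⟩
      trans := fun h₁ h₂ r hr =>
        ⟨(h₁ r hr).1.trans (h₂ r hr).1, (h₂ r hr).2.trans (h₁ r hr).2⟩ }

/-- The space `𝒢₀/≃` of pointed geodesic metric spaces modulo strong equivalence. (Isometric
pointed spaces are strongly equivalent, so that it does not matter whether one passes to isometry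
classes first.) -/
def StrongClasses : Type (u + 1) := Quotient strongSetoid.{u}

/-- The class of a pointed geodesic metric space in `𝒢₀/≃`. -/
def StrongClasses.mk (X : PointedGeodesicSpace.{u}) : StrongClasses.{u} :=
  Quotient.mk strongSetoid X

/-! ## Proper spaces and pointed Gromov-Hausdorff convergence -/

/-- Two pointed metric spaces are isometric if there is an isometry of one onto the other that maps
base point to base point. -/
def PointedIsometric (X : PointedMetricSpace.{u}) (Y : PointedMetricSpace.{v}) : Prop :=
  ∃ e : X ≃ᵢ Y, e X.pt = Y.pt

theorem PointedIsometric.symm {X : PointedMetricSpace.{u}} {Y : PointedMetricSpace.{v}}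
    (h : PointedIsometric X Y) : PointedIsometric Y X := by
  obtain ⟨e, he⟩ := h
  exact ⟨e.symm, by rw [← he, e.symm_apply_apply]⟩

theorem PointedIsometric.precsim_ball {X : PointedMetricSpace.{u}} {Y : PointedMetricSpace.{v}}
    (h : PointedIsometric X Y) (r : ℝ) (hr : 0 < r) :
    Precsim (X.ball r hr) (Y.ball r hr) := by
  obtain ⟨e, he⟩ := h
  refine Precsim.of_isometry (X := X.ball r hr) (Y := Y.ball r hr)
    (fun x => ⟨e x.1, ?_⟩) ?_ (Subtype.ext he)
  · rw [← he, Metric.mem_closedBall, e.isometry.dist_eq]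
    exact x.2
  · exact fun x y => e.isometry.edist_eq x.1 y.1

theorem PointedIsometric.stronglyEquivalent {X : PointedMetricSpace.{u}}
    {Y : PointedMetricSpace.{v}} (h : PointedIsometric X Y) : StronglyEquivalent X Y :=
  fun r hr => ⟨h.precsim_ball r hr, h.symm.precsim_ball r hr⟩

/-- Pointed isometry as an equivalence relation on pointed proper geodesic metric spaces. -/
def properIsometrySetoid : Setoid PointedProperGeodesicSpace.{u} where
  r X Y := PointedIsometric X.toPointedMetricSpace Y.toPointedMetricSpace
  iseqv :=
    { refl := fun _ => ⟨IsometryEquiv.refl _, rfl⟩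
      symm := fun h => h.symm
      trans := fun {_ _ _} h₁ h₂ => by
        obtain ⟨e, he⟩ := h₁
        obtain ⟨f, hf⟩ := h₂
        exact ⟨e.trans f, by simp [he, hf]⟩ }

/-- The space `𝒫𝒢₀` of isometry classes of pointed proper geodesic metric spaces. -/
def ProperClasses : Type (u + 1) := Quotient properIsometrySetoid.{u}

/-- Pointed Gromov-Hausdorff convergence of a sequence of pointed metric spaces `(X n, x n)` to
`(Y, y)`: for any `r, ε > 0` and all large `n` there is a map `f : B(x n, r) → Y` of the open
ball with `f (x n) = y` that changes distances by less than `ε` and such that the `ε`-neighbourhood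
of its image contains the open ball `B(y, r - ε)`. (The values of `f` outside of the ball do not
matter.) -/
def PointedGHTendsto (X : ℕ → PointedMetricSpace.{u}) (Y : PointedMetricSpace.{v}) : Prop :=
  ∀ r > 0, ∀ ε > 0, ∀ᶠ n in atTop, ∃ f : X n → Y,
    f (X n).pt = Y.pt ∧
    (∀ a ∈ Metric.ball (X n).pt r, ∀ b ∈ Metric.ball (X n).pt r,
      |dist (f a) (f b) - dist a b| < ε) ∧
    Metric.ball Y.pt (r - ε) ⊆ Metric.thickening ε (f '' Metric.ball (X n).pt r)

/-- The topology given by pointed Gromov-Hausdorff convergence: a family `U` is open if every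
sequence that converges to a member of `U` is eventually in `U`. -/
instance : TopologicalSpace PointedProperGeodesicSpace.{u} where
  IsOpen U := ∀ Y ∈ U, ∀ X : ℕ → PointedProperGeodesicSpace.{u},
    PointedGHTendsto (fun n => (X n).toPointedMetricSpace) Y.toPointedMetricSpace →
      ∀ᶠ n in atTop, X n ∈ U
  isOpen_univ := fun _ _ _ _ => Eventually.of_forall fun _ => mem_univ _
  isOpen_inter := fun _ _ hU hV Y hY X hX => (hU Y hY.1 X hX).and (hV Y hY.2 X hX)
  isOpen_sUnion := fun _ hS Y hY X hX => by
    obtain ⟨U, hU, hYU⟩ := hY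
    exact (hS U hU Y hYU X hX).mono fun _ h => ⟨U, hU, h⟩

/-- The pointed Gromov-Hausdorff topology on `𝒫𝒢₀` (isometric spaces are limits of the same
sequences, so that every open family above is a union of isometry classes). -/
instance : TopologicalSpace ProperClasses.{u} :=
  inferInstanceAs (TopologicalSpace (Quotient properIsometrySetoid.{u}))

/-- The natural projection `𝒫𝒢₀ → 𝒢₀/≃`. -/
def ProperClasses.toStrongClasses : ProperClasses.{u} → StrongClasses.{u} :=
  Quotient.lift (s := properIsometrySetoid.{u})
    (fun X => StrongClasses.mk X.toPointedGeodesicSpace)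
    (fun _ _ h => Quotient.sound (s := strongSetoid.{u}) (PointedIsometric.stronglyEquivalent h))

/-! ## Pointed ultralimits -/

/-- The sequences of points `a n ∈ X n` at bounded distance from the base points. -/
def BoundedSeq (X : ℕ → PointedMetricSpace.{u}) : Type u :=
  {a : ∀ n, X n // ∃ C : ℝ, ∀ n, dist (a n) (X n).pt ≤ C}

theorem BoundedSeq.tendsto_dist (ω : Ultrafilter ℕ) (X : ℕ → PointedMetricSpace.{u})
    (a b : BoundedSeq X) :
    Tendsto (fun n => dist (a.1 n) (b.1 n)) ω
      (𝓝 (limUnder (ω : Filter ℕ) fun n => dist (a.1 n) (b.1 n))) := by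
  obtain ⟨C, hC⟩ := a.2
  obtain ⟨D, hD⟩ := b.2
  refine tendsto_nhds_limUnder ?_
  have hmem : ∀ n, dist (a.1 n) (b.1 n) ∈ Icc (0 : ℝ) (C + D) := fun n =>
    ⟨dist_nonneg, (dist_triangle_right _ _ (X n).pt).trans (add_le_add (hC n) (hD n))⟩
  obtain ⟨t, -, ht⟩ := isCompact_Icc.ultrafilter_le_nhds
    (ω.map fun n => dist (a.1 n) (b.1 n))
    (le_principal_iff.2 (Filter.mem_map.2 (Eventually.of_forall hmem)))
  exact ⟨t, ht⟩

/-- The pseudometric `d_ω a b = ω-lim d (a n) (b n)` on bounded sequences. -/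
@[reducible] def BoundedSeq.pseudoMetricSpace (ω : Ultrafilter ℕ)
    (X : ℕ → PointedMetricSpace.{u}) : PseudoMetricSpace (BoundedSeq X) where
  dist a b := limUnder (ω : Filter ℕ) fun n => dist (a.1 n) (b.1 n)
  dist_self a := tendsto_nhds_unique (BoundedSeq.tendsto_dist ω X a a) (by simp)
  dist_comm a b := by simp only [dist_comm]
  dist_triangle a b c :=
    le_of_tendsto_of_tendsto' (BoundedSeq.tendsto_dist ω X a c)
      ((BoundedSeq.tendsto_dist ω X a b).add (BoundedSeq.tendsto_dist ω X b c))
      fun _ => dist_triangle _ _ _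

/-- The pointed ultralimit of pointed metric spaces along `ω`: bounded sequences with the
pseudometric `d_ω`, where sequences at distance zero are identified. -/
def pointedUltralimit (ω : Ultrafilter ℕ) (X : ℕ → PointedMetricSpace.{u}) :
    PointedMetricSpace.{u} :=
  letI := BoundedSeq.pseudoMetricSpace ω X
  { carrier := SeparationQuotient (BoundedSeq X)
    pt := SeparationQuotient.mk ⟨fun n => (X n).pt, 0, fun n => by simp⟩ }

end

noncomputable section

/-! ## Approximate domination of finite tuples -/

namespace PointedMetricSpace

/-! Everything is reduced to one elementary relation: a finite pointed tuple of one space is matched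
by a tuple of the other whose distances are at most `ε` smaller. `Precsim` means that this holds for
all sizes `N` and all `ε > 0` (`precsim_iff`), and a small `rhoN` amounts quantitatively to such
matchings in both directions (`dominated_of_rhoN_lt`, `rhoN_le`).

Geodesics allow points of an `r`-ball to be pushed into a smaller `s`-ball at cost `r - s`
(`exists_retraction`). Hence the integrand of `rho0` is continuous in the radius, and a failure of
domination at radius `r` persists on an interval of radii below `r`, which bounds the integral from
below. With dominated convergence this shows that `rho0`-convergence is the same as mutual
approximate domination of the balls of every radius (`exists_ballDominated_of_rho0_lt`,
`tendsto_rho0`). For constant sequences it gives `rho0_eq_zero_iff`.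

Any sequence of geodesic spaces converges in `rho0` to its ultralimit along the ultrafilter
(`tendsto_rho0_ultralimit`). Compactness of the quotient follows, and so does the third claim, by
the triangle inequality.

For proper spaces the additional input is rigidity. A noncontracting self-map of a compact space is
a surjective isometry, so a space that mutually dominates a compact one embeds in it isometrically
and densely (`exists_isometry_denseRange`). Applied to balls, this makes the projection injective
and turns finite nets of the limit into Gromov–Hausdorff approximations
(`eventually_exists_map_of_ultralimit`). The converse, from Gromov–Hausdorff convergence to
domination, only needs the retractions. -/

/-- Every pointed tuple of `N + 1` points of `A` is dominated up to `ε` by one of `B`. -/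
def Dominated (N : ℕ) (ε : ℝ) (A : PointedMetricSpace.{u}) (B : PointedMetricSpace.{v}) : Prop :=
  ∀ x : Fin (N + 1) → A, x 0 = A.pt → ∃ y : Fin (N + 1) → B, y 0 = B.pt ∧
    ∀ i j, dist (x i) (x j) - ε ≤ dist (y i) (y j)

theorem Dominated.mono {N : ℕ} {ε δ : ℝ} {A : PointedMetricSpace.{u}} {B : PointedMetricSpace.{v}}
    (h : Dominated N ε A B) (hεδ : ε ≤ δ) : Dominated N δ A B := by
  intro x hx
  obtain ⟨y, hy, h'⟩ := h x hx
  exact ⟨y, hy, fun i j => by linarith [h' i j]⟩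

theorem Dominated.trans {N : ℕ} {ε δ : ℝ} {A : PointedMetricSpace.{u}}
    {B : PointedMetricSpace.{v}} {C : PointedMetricSpace.{w}}
    (h : Dominated N ε A B) (h' : Dominated N δ B C) : Dominated N (ε + δ) A C := by
  intro x hx
  obtain ⟨y, hy, hxy⟩ := h x hx
  obtain ⟨z, hz, hyz⟩ := h' y hy
  exact ⟨z, hz, fun i j => by linarith [hxy i j, hyz i j]⟩

theorem Dominated.of_map {N : ℕ} {ε : ℝ} {A : PointedMetricSpace.{u}} {B : PointedMetricSpace.{v}}
    (f : A → B) (h0 : f A.pt = B.pt) (hf : ∀ a b, dist a b - ε ≤ dist (f a) (f b)) :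
    Dominated N ε A B :=
  fun x hx => ⟨fun i => f (x i), by simp only [hx, h0], fun i j => hf _ _⟩

/-- Slot `0` is reserved for `i₀`, the other elements sit in slots shifted by one, and slots beyond
the cardinality repeat `i₀`. -/
theorem exists_enumeration {ι : Type u} [Finite ι] {N : ℕ} (hN : Nat.card ι ≤ N) (i₀ : ι) :
    ∃ (e : Fin (N + 1) → ι) (s : ι → Fin (N + 1)), e 0 = i₀ ∧ s i₀ = 0 ∧ ∀ i, e (s i) = i := by
  classical
  have := Fintype.ofFinite ι
  let q := Finite.equivFin ι
  refine ⟨fun k => if h : k ≠ 0 ∧ k.1 - 1 < Nat.card ι then q.symm ⟨k.1 - 1, h.2⟩ else i₀,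
    fun i => if i = i₀ then 0 else ⟨(q i).1 + 1, by have := (q i).2; omega⟩, by simp, by simp, ?_⟩
  intro i
  by_cases h : i = i₀
  · simp [h]
  · simp only [h, if_false]
    rw [dif_pos]
    · simp
    · refine ⟨fun h' => ?_, by simpa only [Nat.add_sub_cancel] using (q i).2⟩
      have := congrArg Fin.val h'
      simp at this

/-- A tuple indexed by a finite set is dominated as well. -/
theorem Dominated.exists_of_finite {N : ℕ} {ε : ℝ} {A : PointedMetricSpace.{u}}
    {B : PointedMetricSpace.{v}} (h : Dominated N ε A B) {ι : Type w} [Finite ι]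
    (hN : Nat.card ι ≤ N) (i₀ : ι) (x : ι → A) (hx : x i₀ = A.pt) :
    ∃ y : ι → B, y i₀ = B.pt ∧ ∀ i j, dist (x i) (x j) - ε ≤ dist (y i) (y j) := by
  obtain ⟨e, s, he, hs, hes⟩ := exists_enumeration hN i₀
  obtain ⟨y, hy, hxy⟩ := h (fun k => x (e k)) (by simp only [he, hx])
  refine ⟨fun i => y (s i), by simp only [hs, hy], fun i j => ?_⟩
  simpa only [hes] using hxy (s i) (s j)

theorem toExt_edist (A : PointedMetricSpace.{u}) (a b : A.toExt) :
    edist a b = ENNReal.ofReal (dist (α := A) a b) := edist_dist (α := A) a b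

/-- A tuple involves only finitely many lower limits, so a single late index serves all pairs at
once. Conversely, approximants with errors `1 / (k + 1)` form the required sequences. -/
theorem precsim_iff {A : PointedMetricSpace.{u}} {B : PointedMetricSpace.{v}} :
    Precsim A.toExt B.toExt ↔ ∀ (N : ℕ) (ε : ℝ), 0 < ε → Dominated N ε A B := by
  constructor
  · intro h N ε hε x hx
    obtain ⟨y, hy, hxy⟩ := h N x hx
    have : ∀ᶠ k in atTop, ∀ i j, dist (x i) (x j) - ε ≤ dist (α := B) (y i k) (y j k) := by
      rw [eventually_all]
      intro i
      rw [eventually_all]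
      intro j
      rcases le_or_gt (dist (x i) (x j) - ε) 0 with h0 | h0
      · exact Eventually.of_forall fun k => h0.trans dist_nonneg
      · have hlt : ENNReal.ofReal (dist (x i) (x j) - ε) < edist (α := A.toExt) (x i) (x j) := by
          refine lt_of_lt_of_eq ?_ (toExt_edist A (x i) (x j)).symm
          rw [ENNReal.ofReal_lt_ofReal_iff_of_nonneg h0.le]
          linarith
        filter_upwards [eventually_lt_of_lt_liminf (hlt.trans_le (hxy i j))] with k hk
        have hk' := hk.trans_eq (toExt_edist B (y i k) (y j k))
        exact ((ENNReal.ofReal_lt_ofReal_iff_of_nonneg h0.le).1 hk').le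
    obtain ⟨k, hk⟩ := this.exists
    exact ⟨fun i => y i k, hy k, hk⟩
  · intro h N x hx
    choose y hy hxy using fun k : ℕ => h N (1 / ((k : ℝ) + 1)) Nat.one_div_pos_of_nat x hx
    refine ⟨fun i k => y k i, hy, fun i j => ?_⟩
    have ht : Tendsto (fun k : ℕ => ENNReal.ofReal (dist (α := A) (x i) (x j) - 1 / ((k : ℝ) + 1)))
        atTop (𝓝 (ENNReal.ofReal (dist (α := A) (x i) (x j) - 0))) :=
      ENNReal.tendsto_ofReal (tendsto_const_nhds.sub tendsto_one_div_add_atTop_nhds_zero_nat)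
    rw [sub_zero] at ht
    refine ((toExt_edist A (x i) (x j)).trans ht.liminf_eq.symm).trans_le ?_
    exact liminf_le_liminf (Eventually.of_forall fun k =>
      (ENNReal.ofReal_le_ofReal (hxy k i j)).trans_eq (toExt_edist B (y k i) (y k j)).symm)

/-! ## Balls, rescaling, subspaces -/

/-- The closed ball about the base point, as a pointed metric space. -/
def closedBall (X : PointedMetricSpace.{u}) (r : ℝ) (hr : 0 < r) : PointedMetricSpace.{u} where
  carrier := Metric.closedBall X.pt r
  pt := ⟨X.pt, Metric.mem_closedBall_self hr.le⟩

theorem closedBall_toExt (X : PointedMetricSpace.{u}) (r : ℝ) (hr : 0 < r) :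
    (X.closedBall r hr).toExt = X.ball r hr := rfl

/-- The metric of `A` multiplied by `t`. -/
def scale (A : PointedMetricSpace.{u}) (t : ℝ) (ht : 0 < t) : PointedMetricSpace.{u} where
  carrier := A
  str :=
    { dist := fun x y => t * dist x y
      dist_self := fun x => by simp
      dist_comm := fun x y => by simp only [dist_comm]
      dist_triangle := fun x y z => by
        rw [← mul_add]
        exact mul_le_mul_of_nonneg_left (dist_triangle x y z) ht.le
      eq_of_dist_eq_zero := fun {x y} h => by
        rcases mul_eq_zero.1 h with h | h
        · exact absurd h ht.ne'
        · exact dist_eq_zero.1 h }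
  pt := A.pt

/-- The rescaled ball as a pointed metric space. -/
def unitBall (X : PointedMetricSpace.{u}) (r : ℝ) (hr : 0 < r) : PointedMetricSpace.{u} :=
  (X.closedBall r hr).scale r⁻¹ (inv_pos.2 hr)

theorem unitBall_dist (X : PointedMetricSpace.{u}) (r : ℝ) (hr : 0 < r)
    (x y : X.unitBall r hr) : dist x y = r⁻¹ * dist (α := X) x.1 y.1 := rfl

theorem unitBall_dist_le (X : PointedMetricSpace.{u}) (r : ℝ) (hr : 0 < r)
    (x y : X.unitBall r hr) : dist x y ≤ 2 := by
  have hx : dist (α := X) x.1 X.pt ≤ r := x.2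
  have hy : dist (α := X) y.1 X.pt ≤ r := y.2
  have := dist_triangle_right (α := X) x.1 y.1 X.pt
  rw [unitBall_dist, inv_mul_le_iff₀ hr]
  linarith

theorem rescaledBall_edist (X : PointedMetricSpace.{u}) (r : ℝ) (hr : 0 < r)
    (x y : X.rescaledBall r hr) : edist x y = edist (α := (X.unitBall r hr).toExt) x y := by
  refine Eq.trans ?_ (toExt_edist (X.unitBall r hr) x y).symm
  change ENNReal.ofReal r⁻¹ * edist (α := X) x.1 y.1 =
    ENNReal.ofReal (r⁻¹ * dist (α := X) x.1 y.1)
  rw [ENNReal.ofReal_mul (inv_pos.2 hr).le, ← edist_dist]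

theorem pyramid_rescaledBall (X : PointedMetricSpace.{u}) (r : ℝ) (hr : 0 < r) :
    pyramid (X.rescaledBall r hr) = pyramid (X.unitBall r hr).toExt := by
  have h1 : Precsim (X.rescaledBall r hr) (X.unitBall r hr).toExt :=
    Precsim.of_isometry id (fun x y => (rescaledBall_edist X r hr x y).symm) rfl
  have h2 : Precsim (X.unitBall r hr).toExt (X.rescaledBall r hr) :=
    Precsim.of_isometry id (fun x y => rescaledBall_edist X r hr x y) rfl
  ext K
  exact ⟨fun h => Precsim.trans h h1, fun h => Precsim.trans h h2⟩

theorem rho_rescaledBall (X : PointedMetricSpace.{u}) (Y : PointedMetricSpace.{v}) (r : ℝ)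
    (hr : 0 < r) : rho (X.rescaledBall r hr) (Y.rescaledBall r hr) =
      rho (X.unitBall r hr).toExt (Y.unitBall r hr).toExt := by
  simp only [rho, rhoN, pyramid_rescaledBall]

/-- The subspace `S` of `A`. -/
def sub (A : PointedMetricSpace.{u}) (S : Set A) (hS : A.pt ∈ S) : PointedMetricSpace.{u} where
  carrier := S
  pt := ⟨A.pt, hS⟩

/-- A finite pointed metric space is isometric to one in `Type`. -/
theorem exists_compact_of_finite (A : PointedMetricSpace.{u}) [Finite A] :
    ∃ (K : PointedCompactSpace) (f : K.toPointedMetricSpace → A), Isometry f ∧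
      Function.Bijective f ∧ f K.pt = A.pt := by
  let q := Finite.equivFin A
  let m : MetricSpace (Fin (Nat.card A)) := MetricSpace.induced q.symm q.symm.injective inferInstance
  refine ⟨{ carrier := Fin (Nat.card A), str := m, pt := q A.pt, compact := ?_ }, q.symm, ?_, ?_, ?_⟩
  · exact @Finite.compactSpace (Fin (Nat.card A)) m.toUniformSpace.toTopologicalSpace _
  · exact Isometry.of_dist_eq fun _ _ => rfl
  · exact q.symm.bijective
  · exact q.symm_apply_apply _

end PointedMetricSpace

/-! ## The pointed Gromov-Hausdorff distance -/

theorem pointedGHDist_le {K L : PointedCompactSpace} {Z : Type} [mZ : MetricSpace Z]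
    [cZ : CompactSpace Z] {φ : K.toPointedMetricSpace → Z} {ψ : L.toPointedMetricSpace → Z}
    (hφ : Isometry φ) (hψ : Isometry ψ) :
    pointedGHDist K L ≤ Metric.hausdorffEDist (range φ) (range ψ) ⊔ edist (φ K.pt) (ψ L.pt) :=
  iInf_le_of_le Z <| iInf_le_of_le mZ <| iInf_le_of_le cZ <| iInf_le_of_le φ <|
    iInf_le_of_le ψ <| iInf_le_of_le hφ <| iInf_le_of_le hψ le_rfl

theorem exists_of_pointedGHDist_lt {K L : PointedCompactSpace} {c : ℝ≥0∞}
    (h : pointedGHDist K L < c) : ∃ (Z : Type) (_ : MetricSpace Z) (_ : CompactSpace Z)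
    (φ : K.toPointedMetricSpace → Z) (ψ : L.toPointedMetricSpace → Z), Isometry φ ∧ Isometry ψ ∧
      Metric.hausdorffEDist (range φ) (range ψ) < c ∧ edist (φ K.pt) (ψ L.pt) < c := by
  simp only [pointedGHDist, iInf_lt_iff, max_lt_iff] at h
  obtain ⟨Z, i1, i2, φ, ψ, hφ, hψ, h1, h2⟩ := h
  exact ⟨Z, i1, i2, φ, ψ, hφ, hψ, h1, h2⟩

theorem pointedGHDist_comm (K L : PointedCompactSpace) :
    pointedGHDist K L = pointedGHDist L K := by
  have : ∀ K L : PointedCompactSpace, pointedGHDist K L ≤ pointedGHDist L K := by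
    intro K L
    refine le_of_forall_gt fun c hc => ?_
    obtain ⟨Z, _, _, φ, ψ, hφ, hψ, h1, h2⟩ := exists_of_pointedGHDist_lt hc
    refine (pointedGHDist_le hψ hφ).trans_lt (max_lt ?_ ?_)
    · rwa [Metric.hausdorffEDist_comm]
    · rwa [edist_comm]
  exact le_antisymm (this K L) (this L K)

/-- The two ambient spaces are glued along their copies of `L`. The infima need not be attained, so
this is done for arbitrary strict upper bounds `a`, `b`. -/
theorem pointedGHDist_triangle (K L M : PointedCompactSpace) :
    pointedGHDist K M ≤ pointedGHDist K L + pointedGHDist L M := by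
  have key : ∀ a b : ℝ≥0∞, pointedGHDist K L < a → pointedGHDist L M < b →
      pointedGHDist K M ≤ a + b := by
    intro a b ha hb
    obtain ⟨Z, _, _, φ, ψ, hφ, hψ, h1, h2⟩ := exists_of_pointedGHDist_lt ha
    obtain ⟨W, _, _, φ', ψ', hφ', hψ', h1', h2'⟩ := exists_of_pointedGHDist_lt hb
    have : Nonempty L.toPointedMetricSpace := ⟨L.pt⟩
    let G := Metric.GlueSpace hψ hφ'
    let l : Z → G := Metric.toGlueL hψ hφ'
    let r : W → G := Metric.toGlueR hψ hφ'
    have hl : Isometry l := Metric.toGlueL_isometry hψ hφ'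
    have hr : Isometry r := Metric.toGlueR_isometry hψ hφ'
    have hlr : l ∘ ψ = r ∘ φ' := Metric.toGlue_commute hψ hφ'
    have hG : CompactSpace G := by
      refine ⟨?_⟩
      have : (univ : Set G) = range l ∪ range r := by
        refine (eq_univ_of_forall fun x => ?_).symm
        obtain ⟨y | y, rfl⟩ := Quotient.exists_rep x
        · exact Or.inl ⟨y, rfl⟩
        · exact Or.inr ⟨y, rfl⟩
      rw [this]
      exact (isCompact_range hl.continuous).union (isCompact_range hr.continuous)
    refine (pointedGHDist_le (hl.comp hφ) (hr.comp hψ')).trans (max_le ?_ ?_)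
    · calc _ ≤ Metric.hausdorffEDist (range (l ∘ φ)) (range (l ∘ ψ)) +
            Metric.hausdorffEDist (range (l ∘ ψ)) (range (r ∘ ψ')) :=
              Metric.hausdorffEDist_triangle
        _ ≤ a + b := by
          refine add_le_add ?_ ?_
          · rw [range_comp, range_comp, Metric.hausdorffEDist_image hl]
            exact h1.le
          · rw [hlr, range_comp, range_comp, Metric.hausdorffEDist_image hr]
            exact h1'.le
    · calc _ ≤ edist (l (φ K.pt)) (l (ψ L.pt)) + edist (l (ψ L.pt)) (r (ψ' M.pt)) :=
              edist_triangle _ _ _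
        _ ≤ a + b := by
          refine add_le_add ?_ ?_
          · rw [hl.edist_eq]
            exact h2.le
          · rw [show l (ψ L.pt) = r (φ' L.pt) from congrFun hlr L.pt, hr.edist_eq]
            exact h2'.le
  rcases eq_or_ne (pointedGHDist K L) ∞ with h | h
  · simp [h]
  rcases eq_or_ne (pointedGHDist L M) ∞ with h' | h'
  · simp [h']
  refine ENNReal.le_of_forall_pos_le_add fun ε hε _ => ?_
  have hε2 : ((ε : ℝ≥0∞) / 2) ≠ 0 := by simp [hε.ne']
  refine (key _ _ (ENNReal.lt_add_right h hε2) (ENNReal.lt_add_right h' hε2)).trans_eq ?_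
  rw [add_add_add_comm, ENNReal.add_halves]

/-- Spaces that agree along maps `p`, `q` of a common index set up to a distortion `2 * ε`, where
the image of `p` is `δ`-dense and that of `q` everything, are at distance at most `δ + ε`. -/
theorem pointedGHDist_le_of_distortion {K L : PointedCompactSpace} {ι : Type}
    (p : ι → K.toPointedMetricSpace) (q : ι → L.toPointedMetricSpace) {ε δ : ℝ} (hε : 0 < ε)
    (hδ : 0 ≤ δ) (hpq : ∀ i j, |dist (p i) (p j) - dist (q i) (q j)| ≤ 2 * ε)
    (i₀ : ι) (hp0 : p i₀ = K.pt) (hq0 : q i₀ = L.pt) (hp : ∀ k, ∃ i, dist k (p i) ≤ δ)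
    (hq : ∀ l, ∃ i, dist l (q i) ≤ δ) :
    pointedGHDist K L ≤ ENNReal.ofReal (δ + ε) := by
  have : Nonempty ι := ⟨i₀⟩
  have := K.compact
  have := L.compact
  -- The metric on the disjoint union that puts `p i` and `q i` at distance `ε`; the distortion
  -- bound `2 * ε` is what the triangle inequality needs.
  let m : MetricSpace (K.toPointedMetricSpace ⊕ L.toPointedMetricSpace) :=
    Metric.glueMetricApprox p q ε hε hpq
  have hl : Isometry (Sum.inl : K.toPointedMetricSpace →
      K.toPointedMetricSpace ⊕ L.toPointedMetricSpace) := Isometry.of_dist_eq fun _ _ => rfl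
  have hr : Isometry (Sum.inr : L.toPointedMetricSpace →
      K.toPointedMetricSpace ⊕ L.toPointedMetricSpace) := Isometry.of_dist_eq fun _ _ => rfl
  have hd : ∀ i, dist (Sum.inl (p i) : K.toPointedMetricSpace ⊕ L.toPointedMetricSpace)
      (Sum.inr (q i)) = ε := fun i => Metric.glueDist_glued_points p q ε i
  have hc : @CompactSpace (K.toPointedMetricSpace ⊕ L.toPointedMetricSpace)
      m.toUniformSpace.toTopologicalSpace := by
    refine ⟨?_⟩
    rw [← range_inl_union_range_inr]
    exact (isCompact_range hl.continuous).union (isCompact_range hr.continuous)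
  refine (pointedGHDist_le (cZ := hc) hl hr).trans (max_le ?_ ?_)
  · refine Metric.hausdorffEDist_le_of_mem_edist ?_ ?_
    · rintro _ ⟨k, rfl⟩
      obtain ⟨i, hi⟩ := hp k
      refine ⟨_, ⟨q i, rfl⟩, ?_⟩
      rw [edist_dist]
      refine ENNReal.ofReal_le_ofReal ((dist_triangle _ (Sum.inl (p i)) _).trans ?_)
      rw [hd, hl.dist_eq]
      gcongr
    · rintro _ ⟨k, rfl⟩
      obtain ⟨i, hi⟩ := hq k
      refine ⟨_, ⟨p i, rfl⟩, ?_⟩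
      rw [edist_dist]
      refine ENNReal.ofReal_le_ofReal ((dist_triangle _ (Sum.inr (q i)) _).trans ?_)
      rw [dist_comm (Sum.inr (q i)), hd, hr.dist_eq]
      gcongr
  · rw [← hp0, ← hq0, edist_dist, hd]
    exact ENNReal.ofReal_le_ofReal (by linarith)

/-! ## The Hausdorff distance of families -/

theorem familyHausdorffDist_comm (A B : Set PointedCompactSpace) :
    familyHausdorffDist A B = familyHausdorffDist B A := by
  rw [familyHausdorffDist, familyHausdorffDist, sup_comm]
  simp only [pointedGHDist_comm]

theorem familyHausdorffDist_triangle (A B C : Set PointedCompactSpace) :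
    familyHausdorffDist A C ≤ familyHausdorffDist A B + familyHausdorffDist B C := by
  have key : ∀ A B C : Set PointedCompactSpace, ∀ X ∈ A, ⨅ Z ∈ C, pointedGHDist X Z ≤
      (⨆ X ∈ A, ⨅ Y ∈ B, pointedGHDist X Y) + ⨆ Y ∈ B, ⨅ Z ∈ C, pointedGHDist Y Z := by
    intro A B C X hX
    refine le_trans ?_ (add_le_add_left
      (le_iSup₂ (f := fun X (_ : X ∈ A) => ⨅ Y ∈ B, pointedGHDist X Y) X hX) _)
    simp only [ENNReal.iInf_add]
    refine le_iInf fun Y => le_iInf fun hY => ?_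
    refine le_trans ?_ (add_le_add_right
      (le_iSup₂ (f := fun Y (_ : Y ∈ B) => ⨅ Z ∈ C, pointedGHDist Y Z) Y hY) _)
    simp only [ENNReal.add_iInf]
    exact le_iInf fun Z => le_iInf fun hZ =>
      (iInf₂_le Z hZ).trans (pointedGHDist_triangle X Y Z)
  refine max_le (iSup₂_le fun X hX => (key A B C X hX).trans
    (add_le_add le_sup_left le_sup_left)) (iSup₂_le fun X hX => ?_)
  have := key C B A X hX
  simp only [fun Z => pointedGHDist_comm Z X]
  refine this.trans ?_
  rw [add_comm, familyHausdorffDist_comm A B, familyHausdorffDist_comm B C]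
  exact add_le_add le_sup_left le_sup_left

theorem familyHausdorffDist_le {A B : Set PointedCompactSpace} {c : ℝ≥0∞}
    (h1 : ∀ K ∈ A, ∃ L ∈ B, pointedGHDist K L ≤ c) (h2 : ∀ L ∈ B, ∃ K ∈ A, pointedGHDist L K ≤ c) :
    familyHausdorffDist A B ≤ c := by
  refine max_le (iSup₂_le fun K hK => ?_) (iSup₂_le fun L hL => ?_)
  · obtain ⟨L, hL, h⟩ := h1 K hK
    exact (iInf₂_le L hL).trans h
  · obtain ⟨K, hK, h⟩ := h2 L hL
    exact (iInf₂_le K hK).trans ((pointedGHDist_comm K L).trans_le h)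

theorem exists_of_familyHausdorffDist_lt {A B : Set PointedCompactSpace} {c : ℝ≥0∞}
    (h : familyHausdorffDist A B < c) {K : PointedCompactSpace} (hK : K ∈ A) :
    ∃ L ∈ B, pointedGHDist K L < c := by
  have h1 := (le_iSup₂ (f := fun X (_ : X ∈ A) => ⨅ Y ∈ B, pointedGHDist X Y) K hK).trans_lt
    (le_sup_left.trans_lt h)
  simp only [iInf_lt_iff] at h1
  obtain ⟨L, hL, h⟩ := h1
  exact ⟨L, hL, h⟩

/-! ## The pseudometrics `ρ_N` and approximate domination -/

namespace PointedMetricSpace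

/-- The points of the tuple form a space in the pyramid of `A`, with at most `N + 1 ≤ M` points. It
has a neighbour `L` in the pyramid of `B`. Passing to `L` costs `2 * ε`, and realising `L` in `B`
costs another `ε`. -/
theorem dominated_of_rhoN_lt {A : PointedMetricSpace.{u}} {B : PointedMetricSpace.{v}} {N M : ℕ}
    (hNM : N + 1 ≤ M) (hA : ∀ x y : A, dist x y ≤ M) {ε : ℝ}
    (h : rhoN M A.toExt B.toExt < ENNReal.ofReal ε) : Dominated N (3 * ε) A B := by
  have hε : 0 < ε := ENNReal.ofReal_pos.1 (bot_le.trans_lt h)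
  intro x hx
  have hS : A.pt ∈ range x := ⟨0, hx⟩
  have : Finite (A.sub (range x) hS) := (finite_range x).to_subtype
  obtain ⟨K, f, hf, hfb, hf0⟩ := exists_compact_of_finite (A.sub (range x) hS)
  have hKA : K ∈ pyramid A.toExt ∩ finiteFamily M M := by
    refine ⟨Precsim.of_isometry (X := K.toExt) (Y := A.toExt) (fun k => (f k).1) ?_ ?_, ?_, ?_⟩
    · exact fun a b => hf a b
    · exact congrArg Subtype.val hf0
    · refine (ENat.card_congr (Equiv.ofBijective f hfb)).trans_le ?_
      refine le_trans ?_ (Nat.cast_le.2 hNM)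
      have h1 : Function.Surjective (fun i => ⟨x i, i, rfl⟩ : Fin (N + 1) → range x) := by
        rintro ⟨_, i, rfl⟩
        exact ⟨i, rfl⟩
      have h2 := Nat.card_le_card_of_surjective _ h1
      rw [Nat.card_fin] at h2
      have h3 : ENat.card (range x) = Nat.card (range x) := ENat.card_eq_coe_natCard _
      exact h3.trans_le (Nat.cast_le.2 h2)
    · intro a b
      rw [← hf.dist_eq]
      exact hA _ _
  obtain ⟨L, hL, hKL⟩ := exists_of_familyHausdorffDist_lt h hKA
  obtain ⟨Z, _, _, φ, ψ, hφ, hψ, h1, h2⟩ := exists_of_pointedGHDist_lt hKL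
  -- Base points must correspond exactly, since domination concerns pointed tuples.
  have hg : ∀ k, ∃ l, edist (φ k) (ψ l) < ENNReal.ofReal ε ∧ (k = K.pt → l = L.pt) := by
    intro k
    by_cases hk : k = K.pt
    · exact ⟨L.pt, by rwa [hk], fun _ => rfl⟩
    · obtain ⟨_, ⟨l, rfl⟩, hl⟩ := Metric.exists_edist_lt_of_hausdorffEDist_lt (mem_range_self k) h1
      exact ⟨l, hl, fun h => absurd h hk⟩
  choose g hg hg0 using hg
  simp only [edist_lt_ofReal] at hg
  choose k hk using fun i => hfb.2 ⟨x i, i, rfl⟩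
  have hk0 : k 0 = K.pt := by
    apply hfb.1
    rw [hk, hf0]
    exact Subtype.ext hx
  obtain ⟨y, hy0, hy⟩ := precsim_iff.1 hL.1 N ε hε (fun i => g (k i)) (hg0 _ hk0)
  refine ⟨y, hy0, fun i j => ?_⟩
  have e1 : dist (x i) (x j) = dist (k i) (k j) := by
    rw [← hf.dist_eq, hk, hk]
    rfl
  have e2 := dist_triangle4 (φ (k i)) (ψ (g (k i))) (ψ (g (k j))) (φ (k j))
  rw [hφ.dist_eq, hψ.dist_eq, dist_comm (ψ (g (k j)))] at e2
  linarith [hy i j, hg (k i), hg (k j)]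

/-- A maximal `s`-separated subset containing the base point is `s`-dense. -/
theorem exists_separated_net (K : PointedMetricSpace.{u}) [Finite K] {s : ℝ} (hs : 0 < s) :
    ∃ T : Set K, K.pt ∈ T ∧ (∀ a ∈ T, ∀ b ∈ T, a ≠ b → s ≤ dist a b) ∧
      ∀ k, ∃ t ∈ T, dist k t ≤ s := by
  obtain ⟨T, hT⟩ := (toFinite {T : Set K | K.pt ∈ T ∧
    ∀ a ∈ T, ∀ b ∈ T, a ≠ b → s ≤ dist a b}).exists_maximal
    ⟨{K.pt}, rfl, by rintro a rfl b rfl h; exact absurd rfl h⟩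
  refine ⟨T, hT.prop.1, hT.prop.2, fun k => ?_⟩
  by_contra! hk
  have hkT : insert k T ⊆ T := by
    refine hT.2 ⟨Or.inr hT.prop.1, ?_⟩ (subset_insert _ _)
    rintro a (rfl | ha) b (rfl | hb) hab
    · exact absurd rfl hab
    · exact (hk b hb).le
    · rw [dist_comm]
      exact (hk a ha).le
    · exact hT.prop.2 a ha b hb hab
  have := hk k (hkT (mem_insert _ _))
  rw [dist_self] at this
  linarith

/-- An additive error is absorbed by thinning and shrinking. On an `s`-separated set the error `s ^
2` is at most `s` times any nonzero distance, so after multiplication by `1 - s` the map to `B`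
contracts nothing. The shrunken net therefore lies in the pyramid of `B` itself, and it is still
close to `K`. -/
theorem exists_pointedGHDist_le {A : PointedMetricSpace.{u}} {B : PointedMetricSpace.{v}} {N : ℕ}
    {s : ℝ} (hs : 0 < s) (hs1 : s < 1) (h : Dominated N (s ^ 2 / 2) A B) {K : PointedCompactSpace}
    (hK : K ∈ pyramid A.toExt ∩ finiteFamily N N) :
    ∃ L ∈ pyramid B.toExt ∩ finiteFamily N N,
      pointedGHDist K L ≤ ENNReal.ofReal (s * (N + 2)) := by
  obtain ⟨hKA, hKN, hKD⟩ := hK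
  have hKfin : Finite K.toPointedMetricSpace :=
    ENat.card_lt_top.1 (hKN.trans_lt (ENat.natCast_lt_top N))
  have hcard : Nat.card K.toPointedMetricSpace ≤ N := by
    rw [ENat.card_eq_coe_natCard] at hKN
    exact Nat.cast_le.1 hKN
  -- The total error `s ^ 2` is one half from `K` to `A` and one half from `A` to `B`.
  obtain ⟨f, hf0, hf⟩ := ((precsim_iff.1 hKA N (s ^ 2 / 2) (by positivity)).trans
    h).exists_of_finite hcard K.pt id rfl
  obtain ⟨T, hT0, hT, hTd⟩ := exists_separated_net K.toPointedMetricSpace hs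
  have : Finite ((K.toPointedMetricSpace.sub T hT0).scale (1 - s) (sub_pos.2 hs1)) :=
    inferInstanceAs (Finite T)
  obtain ⟨L, g, hg, hgb, hg0⟩ := exists_compact_of_finite
    ((K.toPointedMetricSpace.sub T hT0).scale (1 - s) (sub_pos.2 hs1))
  have hgd : ∀ a b, dist a b = (1 - s) * dist (α := K.toPointedMetricSpace) (g a).1 (g b).1 :=
    fun a b => (hg.dist_eq a b).symm
  have hg0' : (g L.pt).1 = K.pt := congrArg Subtype.val hg0
  refine ⟨L, ⟨precsim_iff.2 fun M ε hε => Dominated.of_map (fun l => f (g l).1) ?_ ?_, ?_, ?_⟩, ?_⟩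
  · rw [hg0', hf0]
  · intro a b
    rcases eq_or_ne a b with rfl | hab
    · simp [hε.le]
    · have h1 : s ≤ dist (α := K.toPointedMetricSpace) (g a).1 (g b).1 :=
        hT _ (g a).2 _ (g b).2 fun h => hab (hgb.1 (Subtype.ext h))
      have h2 := hf (g a).1 (g b).1
      rw [hgd]
      simp only [id] at h2
      nlinarith
  · refine le_trans ?_ hKN
    exact ENat.card_le_card_of_injective (f := fun l => (g l).1)
      fun a b h => hgb.1 (Subtype.ext h)
  · intro a b
    rw [hgd]
    have h1 := hKD (g a).1 (g b).1
    have h2 : 0 ≤ dist (α := K.toPointedMetricSpace) (g a).1 (g b).1 := dist_nonneg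
    nlinarith
  -- Shrinking changes distances by at most `s * N`; using `N + 1` keeps the gluing parameter
  -- positive for every `N`.
  · refine (pointedGHDist_le_of_distortion (fun l => (g l).1) id
      (ε := s * (N + 1) / 2) (δ := s) (by positivity) hs.le ?_ L.pt hg0' rfl ?_
      fun l => ⟨l, by simpa using hs.le⟩).trans (ENNReal.ofReal_le_ofReal (by nlinarith))
    · intro a b
      have h1 := hKD (g a).1 (g b).1
      have h2 : 0 ≤ dist (α := K.toPointedMetricSpace) (g a).1 (g b).1 := dist_nonneg
      simp only [id]
      rw [hgd, abs_of_nonneg (by nlinarith)]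
      nlinarith
    · intro k
      obtain ⟨t, ht, hkt⟩ := hTd k
      obtain ⟨l, hl⟩ := hgb.2 ⟨t, ht⟩
      refine ⟨l, ?_⟩
      simp only [hl]
      exact hkt

theorem rhoN_le {A : PointedMetricSpace.{u}} {B : PointedMetricSpace.{v}} {N : ℕ}
    {s : ℝ} (hs : 0 < s) (hs1 : s < 1) (h : Dominated N (s ^ 2 / 2) A B)
    (h' : Dominated N (s ^ 2 / 2) B A) :
    rhoN N A.toExt B.toExt ≤ ENNReal.ofReal (s * (N + 2)) :=
  familyHausdorffDist_le (fun _ hK => exists_pointedGHDist_le hs hs1 h hK)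
    (fun _ hK => exists_pointedGHDist_le hs hs1 h' hK)

/-- The one-point space lies in every pyramid and is within `N + 1` of every member of the family.
This gives a bound of `rhoN` that does not depend on the spaces. -/
theorem exists_pointedGHDist_le_of_finiteFamily (X : PointedExtMetricSpace.{u}) {N : ℕ}
    {K : PointedCompactSpace} (hK : K ∈ finiteFamily N N) :
    ∃ L ∈ pyramid X ∩ finiteFamily N N, pointedGHDist K L ≤ ENNReal.ofReal (N + 1) := by
  refine ⟨{ carrier := Unit, pt := (), compact := inferInstanceAs (CompactSpace Unit) },
    ⟨?_, ?_, ?_⟩, ?_⟩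
  · exact Precsim.of_isometry (fun _ => X.pt)
      (fun a b => by rw [edist_self]; exact (edist_self (α := Unit) ()).symm) rfl
  · refine le_trans ?_ hK.1
    exact ENat.card_le_card_of_injective (f := fun _ : Unit => K.pt) fun _ _ _ => rfl
  · intro x y
    exact (dist_self (α := Unit) ()).trans_le (Nat.cast_nonneg N)
  · exact pointedGHDist_le_of_distortion (ι := Unit) (fun _ => K.pt) id (ε := 1) (δ := N)
      one_pos (Nat.cast_nonneg N)
      (fun i j => by
        rw [dist_self]
        change |(0 : ℝ) - 0| ≤ _
        norm_num)
      () rfl rfl (fun k => ⟨(), hK.2 _ _⟩) fun l => ⟨(), Nat.cast_nonneg N⟩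

end PointedMetricSpace

open PointedMetricSpace

/-! ### Finiteness, triangle inequality and convergence for `ρ` -/

theorem rhoN_le_natCast (N : ℕ) (X : PointedExtMetricSpace.{u}) (Y : PointedExtMetricSpace.{v}) :
    rhoN N X Y ≤ ENNReal.ofReal (N + 1) :=
  familyHausdorffDist_le (fun _ hK => exists_pointedGHDist_le_of_finiteFamily Y hK.2)
    (fun _ hK => exists_pointedGHDist_le_of_finiteFamily X hK.2)

theorem rhoN_ne_top (N : ℕ) (X : PointedExtMetricSpace.{u}) (Y : PointedExtMetricSpace.{v}) :
    rhoN N X Y ≠ ∞ := ne_top_of_le_ne_top ENNReal.ofReal_ne_top (rhoN_le_natCast N X Y)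

theorem rhoN_toReal_le (N : ℕ) (X : PointedExtMetricSpace.{u}) (Y : PointedExtMetricSpace.{v}) :
    (rhoN N X Y).toReal ≤ N + 1 :=
  ENNReal.toReal_le_of_le_ofReal (by positivity) (rhoN_le_natCast N X Y)

theorem rho_toReal (X : PointedExtMetricSpace.{u}) (Y : PointedExtMetricSpace.{v}) :
    (rho X Y).toReal = ∑' N : ℕ, (1 / 2 : ℝ) ^ (N + 1) * (rhoN (N + 1) X Y).toReal := by
  rw [rho, ENNReal.tsum_toReal_eq]
  · simp
  · exact fun N => ENNReal.mul_ne_top (by simp) (rhoN_ne_top _ _ _)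

theorem summable_rho_bound :
    Summable fun N : ℕ => (1 / 2 : ℝ) ^ (N + 1) * ((N + 1 : ℕ) + 1 : ℝ) := by
  have h1 : Summable fun N : ℕ => ((N : ℝ) ^ 1 * (1 / 2 : ℝ) ^ N) :=
    summable_pow_mul_geometric_of_norm_lt_one 1 (by norm_num)
  have h2 : Summable fun N : ℕ => ((1 / 2 : ℝ) ^ N) := summable_geometric_two
  refine ((h1.mul_left (1 / 2)).add h2).congr fun N => ?_
  push_cast
  ring

/-- A bound of `ρ`. -/
def rhoBound : ℝ := ∑' N : ℕ, (1 / 2 : ℝ) ^ (N + 1) * ((N + 1 : ℕ) + 1 : ℝ)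

theorem summable_rho (X : PointedExtMetricSpace.{u}) (Y : PointedExtMetricSpace.{v}) :
    Summable fun N : ℕ => (1 / 2 : ℝ) ^ (N + 1) * (rhoN (N + 1) X Y).toReal :=
  Summable.of_nonneg_of_le (fun N => by positivity)
    (fun N => by gcongr; exact rhoN_toReal_le _ _ _) summable_rho_bound

theorem rho_toReal_le (X : PointedExtMetricSpace.{u}) (Y : PointedExtMetricSpace.{v}) :
    (rho X Y).toReal ≤ rhoBound := by
  rw [rho_toReal]
  exact (summable_rho X Y).tsum_le_tsum
    (fun N => by gcongr; exact rhoN_toReal_le _ _ _) summable_rho_bound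

theorem rho_ne_top (X : PointedExtMetricSpace.{u}) (Y : PointedExtMetricSpace.{v}) :
    rho X Y ≠ ∞ := by
  have h : rho X Y ≤ ∑' N : ℕ, ENNReal.ofReal ((1 / 2 : ℝ) ^ (N + 1) * ((N + 1 : ℕ) + 1 : ℝ)) := by
    refine ENNReal.tsum_le_tsum fun N => ?_
    rw [ENNReal.ofReal_mul (by positivity), ENNReal.ofReal_pow (by positivity)]
    gcongr
    · simp
    · exact rhoN_le_natCast _ _ _
  refine ne_top_of_le_ne_top ?_ h
  rw [← ENNReal.ofReal_tsum_of_nonneg (fun N => by positivity) summable_rho_bound]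
  exact ENNReal.ofReal_ne_top

theorem rho_comm (X : PointedExtMetricSpace.{u}) (Y : PointedExtMetricSpace.{v}) :
    rho X Y = rho Y X := by
  simp only [rho, rhoN, familyHausdorffDist_comm (pyramid X ∩ _)]

theorem rho_triangle (X : PointedExtMetricSpace.{u}) (Y : PointedExtMetricSpace.{v})
    (Z : PointedExtMetricSpace.{w}) : rho X Z ≤ rho X Y + rho Y Z := by
  rw [rho, rho, rho, ← ENNReal.tsum_add]
  refine ENNReal.tsum_le_tsum fun N => ?_
  rw [← mul_add]
  gcongr
  exact familyHausdorffDist_triangle _ _ _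

theorem rho_toReal_triangle (X : PointedExtMetricSpace.{u}) (Y : PointedExtMetricSpace.{v})
    (Z : PointedExtMetricSpace.{w}) :
    (rho X Z).toReal ≤ (rho X Y).toReal + (rho Y Z).toReal := by
  rw [← ENNReal.toReal_add (rho_ne_top _ _) (rho_ne_top _ _)]
  exact ENNReal.toReal_mono (ENNReal.add_ne_top.2 ⟨rho_ne_top _ _, rho_ne_top _ _⟩)
    (rho_triangle X Y Z)

theorem rhoN_toReal_le_rho (N : ℕ) (X : PointedExtMetricSpace.{u})
    (Y : PointedExtMetricSpace.{v}) :
    (1 / 2 : ℝ) ^ (N + 1) * (rhoN (N + 1) X Y).toReal ≤ (rho X Y).toReal := by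
  rw [rho_toReal]
  exact (summable_rho X Y).le_tsum N fun _ _ => by positivity

/-- Dominated convergence for series: each term tends to zero by `rhoN_le`, and the uniform bounds
of the terms are summable. -/
theorem tendsto_rho {ι : Type*} {l : Filter ι} {A : ι → PointedMetricSpace.{u}}
    {B : ι → PointedMetricSpace.{v}} (h : ∀ (N : ℕ) (ε : ℝ), 0 < ε → ∀ᶠ i in l,
      Dominated N ε (A i) (B i) ∧ Dominated N ε (B i) (A i)) :
    Tendsto (fun i => (rho (A i).toExt (B i).toExt).toReal) l (𝓝 0) := by
  simp only [rho_toReal]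
  rw [← tsum_zero (α := ℝ) (β := ℕ)]
  refine tendsto_tsum_of_dominated_convergence summable_rho_bound (fun N => ?_)
    (Eventually.of_forall fun i N => ?_)
  · rw [← mul_zero ((1 / 2 : ℝ) ^ (N + 1))]
    refine Tendsto.const_mul _ ?_
    rw [Metric.tendsto_nhds]
    intro ε hε
    -- Chosen so that the bound `s * ((N + 1) + 2)` of `rhoN_le` is below `ε`.
    let s := min (1 / 2) (ε / (2 * ((N + 1 : ℕ) + 2)))
    have hs : 0 < s := by positivity
    have hs1 : s < 1 := (min_le_left _ _).trans_lt (by norm_num)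
    have hs2 : s * ((N + 1 : ℕ) + 2) < ε := by
      have : s ≤ ε / (2 * ((N + 1 : ℕ) + 2)) := min_le_right _ _
      rw [le_div_iff₀ (by positivity)] at this
      nlinarith
    filter_upwards [h (N + 1) (s ^ 2 / 2) (by positivity)] with i hi
    rw [Real.dist_0_eq_abs, abs_of_nonneg ENNReal.toReal_nonneg]
    exact (ENNReal.toReal_le_of_le_ofReal (by positivity) (rhoN_le hs hs1 hi.1 hi.2)).trans_lt hs2
  · rw [Real.norm_of_nonneg (by positivity)]
    gcongr
    exact rhoN_toReal_le _ _ _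

namespace PointedMetricSpace

/-! ## Domination of balls -/

/-- Approximate domination of tuples of points of the closed `r`-balls. -/
def BallDominated (N : ℕ) (ε : ℝ) (X : PointedMetricSpace.{u}) (Y : PointedMetricSpace.{v})
    (r : ℝ) : Prop :=
  ∀ x : Fin (N + 1) → X, x 0 = X.pt → (∀ i, dist (x i) X.pt ≤ r) →
    ∃ y : Fin (N + 1) → Y, y 0 = Y.pt ∧ (∀ i, dist (y i) Y.pt ≤ r) ∧
      ∀ i j, dist (x i) (x j) - ε ≤ dist (y i) (y j)

variable {X : PointedMetricSpace.{u}} {Y : PointedMetricSpace.{v}} {N : ℕ} {ε r : ℝ}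

theorem dominated_closedBall_iff (hr : 0 < r) :
    Dominated N ε (X.closedBall r hr) (Y.closedBall r hr) ↔ BallDominated N ε X Y r := by
  constructor
  · intro h x hx hxr
    obtain ⟨y, hy, hxy⟩ := h (fun i => ⟨x i, hxr i⟩) (Subtype.ext hx)
    exact ⟨fun i => (y i).1, congrArg Subtype.val hy, fun i => (y i).2, hxy⟩
  · intro h x hx
    obtain ⟨y, hy, hyr, hxy⟩ := h (fun i => (x i).1) (congrArg Subtype.val hx) fun i => (x i).2
    exact ⟨fun i => ⟨y i, hyr i⟩, Subtype.ext hy, hxy⟩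

theorem dominated_unitBall_iff (hr : 0 < r) :
    Dominated N ε (X.unitBall r hr) (Y.unitBall r hr) ↔ BallDominated N (r * ε) X Y r := by
  rw [← dominated_closedBall_iff hr]
  have key : ∀ a b : ℝ, r⁻¹ * a - ε ≤ r⁻¹ * b ↔ a - r * ε ≤ b := fun a b => by
    rw [← mul_le_mul_iff_right₀ hr, mul_sub, mul_inv_cancel_left₀ hr.ne',
      mul_inv_cancel_left₀ hr.ne']
  refine forall_congr' fun x => imp_congr Iff.rfl (exists_congr fun y => and_congr Iff.rfl
    (forall_congr' fun i => forall_congr' fun j => key _ _))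

theorem precsim_ball_iff (hr : 0 < r) :
    Precsim (X.ball r hr) (Y.ball r hr) ↔ ∀ (N : ℕ) (ε : ℝ), 0 < ε → BallDominated N ε X Y r := by
  simp only [← dominated_closedBall_iff hr, ← precsim_iff, closedBall_toExt]

/-- Points of a geodesic space are pushed into the closed `s`-ball at minimal cost. -/
theorem exists_retraction (hX : IsGeodesicSpace X) {s : ℝ} (hs : 0 ≤ s) :
    ∃ g : X → X, g X.pt = X.pt ∧ ∀ x, dist (g x) X.pt ≤ s ∧
      dist x (g x) ≤ max (dist x X.pt - s) 0 := by
  have : ∀ x : X, ∃ y : X, dist y X.pt ≤ s ∧ dist x y ≤ max (dist x X.pt - s) 0 := by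
    intro x
    obtain ⟨γ, h0, h1, h⟩ := hX X.pt x
    have hd : 0 ≤ dist X.pt x := dist_nonneg
    have hm : min s (dist X.pt x) ∈ Icc 0 (dist X.pt x) := ⟨le_min hs hd, min_le_right _ _⟩
    refine ⟨γ (min s (dist X.pt x)), ?_, ?_⟩
    · nth_rw 2 [← h0]
      rw [h _ hm _ ⟨le_rfl, hd⟩, sub_zero, abs_of_nonneg hm.1]
      exact min_le_left _ _
    · nth_rw 1 [← h1]
      rw [h _ ⟨hd, le_rfl⟩ _ hm, abs_of_nonneg (sub_nonneg.2 hm.2), dist_comm x]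
      rcases le_total s (dist X.pt x) with h' | h'
      · rw [min_eq_left h']
        exact le_max_left _ _
      · simp [h']
  choose g hg hg' using this
  refine ⟨g, ?_, fun x => ⟨hg x, hg' x⟩⟩
  -- The base point is moved by at most `max (0 - s) 0 = 0`.
  have := hg' X.pt
  rw [dist_self, max_eq_right (by linarith)] at this
  exact (dist_le_zero.1 this).symm

theorem dist_sub_le_of_near (x x' y y' : X) : dist x x' - (dist x y + dist x' y') ≤ dist y y' := by
  have := dist_triangle4 x y y' x'
  rw [dist_comm y' x'] at this
  linarith

theorem BallDominated.mono {δ : ℝ} (h : BallDominated N ε X Y r) (hεδ : ε ≤ δ) :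
    BallDominated N δ X Y r := by
  intro x hx hxr
  obtain ⟨y, hy, hyr, h'⟩ := h x hx hxr
  exact ⟨y, hy, hyr, fun i j => by linarith [h' i j]⟩

/-- Retracting the tuple into the `s`-ball moves each point by at most `r - s`, so each distance
loses at most `2 * (r - s)`. -/
theorem BallDominated.of_smaller (hX : IsGeodesicSpace X) {s : ℝ} (hs : 0 ≤ s) (hsr : s ≤ r)
    (h : BallDominated N ε X Y s) : BallDominated N (ε + 2 * (r - s)) X Y r := by
  obtain ⟨g, hg0, hg⟩ := exists_retraction hX hs
  intro x hx hxr
  obtain ⟨y, hy, hyr, hxy⟩ := h (fun i => g (x i)) (by simp only [hx, hg0]) fun i => (hg _).1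
  refine ⟨y, hy, fun i => (hyr i).trans hsr, fun i j => ?_⟩
  have h1 : ∀ i, dist (x i) (g (x i)) ≤ r - s := fun i =>
    (hg (x i)).2.trans (max_le (by linarith [hxr i]) (by linarith))
  linarith [hxy i j, dist_sub_le_of_near (x i) (x j) (g (x i)) (g (x j)), h1 i, h1 j]

/-- Before division by `s`, the retraction costs `2 * |r - s|`, and the change of scale costs
another `2 * |r - s|` because the rescaled distances are at most `2`. -/
theorem dominated_unitBall_of_radii (hX : IsGeodesicSpace X) {s : ℝ} (hr : 0 < r) (hs : 0 < s) :
    Dominated N (4 * |r - s| / s) (X.unitBall r hr) (X.unitBall s hs) := by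
  obtain ⟨g, hg0, hg⟩ := exists_retraction hX hs.le
  refine Dominated.of_map (A := X.unitBall r hr) (B := X.unitBall s hs)
    (fun x => ⟨g x.1, (hg _).1⟩) (Subtype.ext hg0) ?_
  rintro ⟨a, ha⟩ ⟨b, hb⟩
  change r⁻¹ * dist a b - 4 * |r - s| / s ≤ s⁻¹ * dist (g a) (g b)
  have h1 : ∀ x ∈ Metric.closedBall X.pt r, dist x (g x) ≤ |r - s| := fun x hx =>
    (hg x).2.trans (max_le ((sub_le_sub_right (Metric.mem_closedBall.1 hx) s).trans
      (le_abs_self _)) (abs_nonneg _))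
  have h2 := dist_sub_le_of_near a b (g a) (g b)
  have h3 := h1 a ha
  have h4 := h1 b hb
  have h5 : dist a b ≤ 2 * r := by
    linarith [dist_triangle_right a b X.pt, Metric.mem_closedBall.1 ha, Metric.mem_closedBall.1 hb]
  have h6 : s * (r⁻¹ * dist a b) ≤ dist a b + 2 * |r - s| := by
    have h7 : 0 ≤ r⁻¹ * dist a b := by positivity
    have h8 : r⁻¹ * dist a b ≤ 2 := by
      rw [inv_mul_le_iff₀ hr]
      linarith
    have h9 : r * (r⁻¹ * dist a b) = dist a b := mul_inv_cancel_left₀ hr.ne' _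
    have h10 : s - r ≤ |r - s| := by
      rw [abs_sub_comm]
      exact le_abs_self _
    nlinarith [abs_nonneg (r - s)]
  rw [← mul_le_mul_iff_right₀ hs, mul_sub, mul_inv_cancel_left₀ hs.ne', mul_div_cancel₀ _ hs.ne']
  linarith

/-- By the triangle inequality for `rho` it suffices that the rescaled balls of each space depend
continuously on the radius. The resulting continuity of the integrand supplies its measurability. -/
theorem continuousAt_rho_unitBall {Y : PointedMetricSpace.{v}} (hX : IsGeodesicSpace X)
    (hY : IsGeodesicSpace Y) (hr : 0 < r) :
    Tendsto (fun s : Ioi (0 : ℝ) => (rho (X.unitBall s s.2).toExt (Y.unitBall s s.2).toExt).toReal)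
      (𝓝 ⟨r, hr⟩) (𝓝 (rho (X.unitBall r hr).toExt (Y.unitBall r hr).toExt).toReal) := by
  have h1 : ∀ ε : ℝ, 0 < ε → ∀ᶠ s : Ioi (0 : ℝ) in 𝓝 ⟨r, hr⟩,
      4 * |r - s| / s ≤ ε ∧ 4 * |s - r| / r ≤ ε := by
    intro ε hε
    have c1 : ContinuousAt (fun s : Ioi (0 : ℝ) => 4 * |r - s| / (s : ℝ)) ⟨r, hr⟩ := by
      refine ContinuousAt.div ?_ continuous_subtype_val.continuousAt hr.ne'
      fun_prop
    have c2 : ContinuousAt (fun s : Ioi (0 : ℝ) => 4 * |s - r| / r) ⟨r, hr⟩ := by fun_prop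
    exact ((c1.eventually (ge_mem_nhds (by simpa using hε))).and
      (c2.eventually (ge_mem_nhds (by simpa using hε))))
  have hX' : Tendsto (fun s : Ioi (0 : ℝ) =>
      (rho (X.unitBall s s.2).toExt (X.unitBall r hr).toExt).toReal) (𝓝 ⟨r, hr⟩) (𝓝 0) :=
    tendsto_rho fun N ε hε => (h1 ε hε).mono fun s hs =>
      ⟨(dominated_unitBall_of_radii hX _ _).mono hs.2,
        (dominated_unitBall_of_radii hX _ _).mono hs.1⟩
  have hY' : Tendsto (fun s : Ioi (0 : ℝ) =>
      (rho (Y.unitBall s s.2).toExt (Y.unitBall r hr).toExt).toReal) (𝓝 ⟨r, hr⟩) (𝓝 0) :=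
    tendsto_rho fun N ε hε => (h1 ε hε).mono fun s hs =>
      ⟨(dominated_unitBall_of_radii hY _ _).mono hs.2,
        (dominated_unitBall_of_radii hY _ _).mono hs.1⟩
  have hsum := hX'.add hY'
  rw [add_zero] at hsum
  rw [tendsto_iff_dist_tendsto_zero]
  refine squeeze_zero (fun _ => dist_nonneg) (fun s => ?_) hsum
  have t1 := rho_toReal_triangle (X.unitBall s s.2).toExt (X.unitBall r hr).toExt
    (Y.unitBall s s.2).toExt
  have t2 := rho_toReal_triangle (X.unitBall r hr).toExt (Y.unitBall r hr).toExt
    (Y.unitBall s s.2).toExt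
  have t3 := rho_toReal_triangle (X.unitBall r hr).toExt (X.unitBall s s.2).toExt
    (Y.unitBall r hr).toExt
  have t4 := rho_toReal_triangle (X.unitBall s s.2).toExt (Y.unitBall s s.2).toExt
    (Y.unitBall r hr).toExt
  rw [rho_comm (X.unitBall r hr).toExt (X.unitBall s s.2).toExt] at t3
  rw [rho_comm (Y.unitBall r hr).toExt (Y.unitBall s s.2).toExt] at t2
  rw [Real.dist_eq, abs_le]
  constructor <;> linarith

end PointedMetricSpace

open PointedMetricSpace

/-! ## The pseudometric `ρ₀` -/

theorem rho0Integrand_of_pos (X Y : PointedGeodesicSpace.{u}) {r : ℝ} (hr : 0 < r) :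
    rho0Integrand X Y r = (rho (X.unitBall r hr).toExt (Y.unitBall r hr).toExt).toReal *
      (r * Real.exp (-r ^ 2)) := by
  rw [rho0Integrand, dif_pos hr, rho_rescaledBall]

theorem rho0Integrand_nonneg (X Y : PointedGeodesicSpace.{u}) (r : ℝ) :
    0 ≤ rho0Integrand X Y r := by
  rw [rho0Integrand]
  split_ifs with hr
  · positivity
  · exact le_rfl

theorem rho0Integrand_le (X Y : PointedGeodesicSpace.{u}) {r : ℝ} (hr : 0 < r) :
    rho0Integrand X Y r ≤ rhoBound * (r * Real.exp (-r ^ 2)) := by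
  rw [rho0Integrand_of_pos X Y hr]
  gcongr
  exact rho_toReal_le _ _

theorem continuousOn_rho0Integrand (X Y : PointedGeodesicSpace.{u}) :
    ContinuousOn (rho0Integrand X Y) (Ioi 0) := by
  rw [continuousOn_iff_continuous_domRestrict, continuous_iff_continuousAt]
  rintro ⟨r, hr⟩
  have : (Ioi (0 : ℝ)).domRestrict (rho0Integrand X Y) = fun s : Ioi (0 : ℝ) =>
      (rho (X.unitBall s s.2).toExt (Y.unitBall s s.2).toExt).toReal *
        ((s : ℝ) * Real.exp (-(s : ℝ) ^ 2)) := funext fun s => rho0Integrand_of_pos X Y s.2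
  rw [this]
  have hc : ContinuousAt (fun s : Ioi (0 : ℝ) => (s : ℝ) * Real.exp (-(s : ℝ) ^ 2)) ⟨r, hr⟩ := by
    fun_prop
  exact (continuousAt_rho_unitBall X.geodesic Y.geodesic hr).mul hc

theorem integrableOn_weight :
    IntegrableOn (fun r : ℝ => rhoBound * (r * Real.exp (-r ^ 2))) (Ioi 0) := by
  have := (integrable_mul_exp_neg_mul_sq (b := 1) one_pos).const_mul rhoBound
  simp only [neg_mul, one_mul] at this
  exact this.integrableOn

theorem integrableOn_rho0Integrand (X Y : PointedGeodesicSpace.{u}) :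
    IntegrableOn (rho0Integrand X Y) (Ioi 0) := by
  refine integrableOn_weight.mono'
    ((continuousOn_rho0Integrand X Y).aestronglyMeasurable measurableSet_Ioi) ?_
  refine (ae_restrict_iff' measurableSet_Ioi).2 (Eventually.of_forall fun r hr => ?_)
  rw [Real.norm_of_nonneg (rho0Integrand_nonneg X Y r)]
  exact rho0Integrand_le X Y hr

theorem rho0_nonneg (X Y : PointedGeodesicSpace.{u}) : 0 ≤ rho0 X Y :=
  integral_nonneg fun r => rho0Integrand_nonneg X Y r

theorem rho0_comm (X Y : PointedGeodesicSpace.{u}) : rho0 X Y = rho0 Y X := by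
  simp only [rho0, rho0Integrand, fun r hr => rho_comm (X.rescaledBall r hr)]

theorem rho0_triangle (X Y Z : PointedGeodesicSpace.{u}) :
    rho0 X Z ≤ rho0 X Y + rho0 Y Z := by
  rw [rho0, rho0, rho0, ← integral_add (integrableOn_rho0Integrand X Y)
    (integrableOn_rho0Integrand Y Z)]
  refine setIntegral_mono_on (integrableOn_rho0Integrand X Z)
    ((integrableOn_rho0Integrand X Y).add (integrableOn_rho0Integrand Y Z)) measurableSet_Ioi
    fun r hr => ?_
  rw [mem_Ioi] at hr
  rw [rho0Integrand_of_pos X Z hr, rho0Integrand_of_pos X Y hr,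
    rho0Integrand_of_pos Y Z hr, ← add_mul]
  gcongr
  exact rho_toReal_triangle _ _ _

/-- Spaces at small `ρ₀`-distance have balls that nearly dominate one another. -/
theorem exists_ballDominated_of_rho0_lt (N : ℕ) {ε r : ℝ} (hε : 0 < ε) (hr : 0 < r) :
    ∃ c > 0, ∀ X Y : PointedGeodesicSpace.{u}, rho0 X Y < c →
      BallDominated N ε X.toPointedMetricSpace Y.toPointedMetricSpace r := by
  -- With `δ ≤ ε / 4`, changing the radius by at most `δ` costs at most `ε / 2`; with `δ ≤ r / 2`,
  -- the radii stay above `r / 2`.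
  let δ := min (ε / 4) (r / 2)
  have hδ : 0 < δ := by positivity
  have hδε : δ ≤ ε / 4 := min_le_left _ _
  have hδr : δ ≤ r / 2 := min_le_right _ _
  -- A lower bound of the integrand on `[r - δ, r]`: the weight of one term of `rho`, a lower bound
  -- of that term, and a lower bound of `s * exp (-s ^ 2)`.
  let c := (1 / 2 : ℝ) ^ (N + 1 + 1) * (ε / (6 * r)) * (r / 2 * Real.exp (-r ^ 2))
  have hc : 0 < c := by positivity
  refine ⟨c * δ, by positivity, fun X Y h => ?_⟩
  by_contra hnot
  refine absurd h (not_lt.2 ?_)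
  have hle : ∀ s ∈ Icc (r - δ) r, c ≤ rho0Integrand X Y s := by
    intro s hs
    have hs0 : 0 < s := by linarith [hs.1]
    have h1 : ¬ BallDominated N (ε / 2) X.toPointedMetricSpace Y.toPointedMetricSpace s := fun h' =>
      hnot ((h'.of_smaller X.geodesic hs0.le hs.2).mono (by linarith [hs.1]))
    -- The index `N + 2` admits `N + 1` points and diameter `2`. The factor `6` is `3` from
    -- `dominated_of_rhoN_lt` times `2` from the remaining tolerance `ε / 2`.
    have h2 : ε / (6 * r) ≤ (rhoN (N + 1 + 1) (X.unitBall s hs0).toExt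
        (Y.unitBall s hs0).toExt).toReal := by
      by_contra! h3
      rw [← ENNReal.lt_ofReal_iff_toReal_lt (rhoN_ne_top _ _ _)] at h3
      have h4 := dominated_of_rhoN_lt (N := N) (by omega) (fun x y =>
        (unitBall_dist_le _ s hs0 x y).trans (by push_cast; linarith [Nat.cast_nonneg (α := ℝ) N]))
        h3
      refine h1 (((dominated_unitBall_iff hs0).1 h4).mono ?_)
      rw [show s * (3 * (ε / (6 * r))) = s / r * (ε / 2) by field_simp; ring]
      have : s / r ≤ 1 := (div_le_one hr).2 hs.2
      nlinarith
    rw [rho0Integrand_of_pos X Y hs0]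
    refine mul_le_mul ((mul_le_mul_of_nonneg_left h2 (by positivity)).trans
      (rhoN_toReal_le_rho (N + 1) _ _)) (mul_le_mul (by linarith [hs.1]) ?_ (by positivity) hs0.le)
      (by positivity) ENNReal.toReal_nonneg
    refine Real.exp_le_exp.2 ?_
    have := hs.2
    nlinarith
  have hsub : Icc (r - δ) r ⊆ Ioi 0 := fun s hs => by
    rw [mem_Ioi]
    linarith [hs.1]
  calc c * δ = ∫ _ in Icc (r - δ) r, c := by
        simp [hδ.le, mul_comm]
    _ ≤ ∫ s in Icc (r - δ) r, rho0Integrand X Y s :=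
        setIntegral_mono_on (by simp) ((integrableOn_rho0Integrand X Y).mono_set hsub)
          measurableSet_Icc hle
    _ ≤ rho0 X Y := setIntegral_mono_set (integrableOn_rho0Integrand X Y)
        (Eventually.of_forall fun s => rho0Integrand_nonneg X Y s) hsub.eventuallyLE

/-- Domination at each fixed radius gives pointwise convergence of the integrand by `tendsto_rho`;
dominated convergence with the weight `rhoBound * (r * exp (-r ^ 2))` does the rest. -/
theorem tendsto_rho0 {ι : Type*} {l : Filter ι} [l.IsCountablyGenerated]
    {X : ι → PointedGeodesicSpace.{u}} {Y : PointedGeodesicSpace.{u}}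
    (h : ∀ (N : ℕ) (ε r : ℝ), 0 < ε → 0 < r → ∀ᶠ i in l,
      BallDominated N ε (X i).toPointedMetricSpace Y.toPointedMetricSpace r ∧
      BallDominated N ε Y.toPointedMetricSpace (X i).toPointedMetricSpace r) :
    Tendsto (fun i => rho0 (X i) Y) l (𝓝 0) := by
  have h0 : ∫ r in Ioi (0 : ℝ), (0 : ℝ) = 0 := by simp
  rw [← h0]
  refine tendsto_integral_filter_of_dominated_convergence
    (fun r : ℝ => rhoBound * (r * Real.exp (-r ^ 2)))
    (Eventually.of_forall fun i => (integrableOn_rho0Integrand (X i) Y).aestronglyMeasurable)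
    (Eventually.of_forall fun i => ?_) integrableOn_weight ?_
  · refine (ae_restrict_iff' measurableSet_Ioi).2 (Eventually.of_forall fun r hr => ?_)
    rw [Real.norm_of_nonneg (rho0Integrand_nonneg _ _ r)]
    exact rho0Integrand_le _ _ hr
  · refine (ae_restrict_iff' measurableSet_Ioi).2 (Eventually.of_forall fun r hr => ?_)
    rw [mem_Ioi] at hr
    simp only [fun i => rho0Integrand_of_pos (X i) Y hr]
    rw [← zero_mul (r * Real.exp (-r ^ 2))]
    refine Tendsto.mul_const _ (tendsto_rho fun N ε hε => ?_)
    simp only [dominated_unitBall_iff]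
    exact h N (r * ε) r (mul_pos hr hε) hr

theorem rho0_eq_zero_iff (X Y : PointedGeodesicSpace.{u}) :
    rho0 X Y = 0 ↔ StronglyEquivalent X.toPointedMetricSpace Y.toPointedMetricSpace := by
  constructor
  · have : ∀ X Y : PointedGeodesicSpace.{u}, rho0 X Y = 0 → ∀ (r : ℝ) (hr : 0 < r),
        Precsim (X.ball r hr) (Y.ball r hr) := by
      intro X Y h r hr
      refine (precsim_ball_iff hr).2 fun N ε hε => ?_
      obtain ⟨c, hc, h'⟩ := exists_ballDominated_of_rho0_lt.{u} N hε hr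
      exact h' X Y (h.trans_lt hc)
    exact fun h r hr => ⟨this X Y h r hr, this Y X ((rho0_comm Y X).trans h) r hr⟩
  · intro h
    -- A constant family that tends to zero is zero.
    have := tendsto_rho0 (l := (⊤ : Filter Unit)) (X := fun _ => X) (Y := Y)
      fun N ε r hε hr => Eventually.of_forall fun _ =>
        ⟨(precsim_ball_iff hr).1 (h r hr).1 N ε hε, (precsim_ball_iff hr).1 (h r hr).2 N ε hε⟩
    exact tendsto_nhds_unique tendsto_const_nhds this

namespace PointedMetricSpace

/-! ## Ultralimits -/

/-- The point of the ultralimit given by a bounded sequence. -/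
def ultralimitMk (ω : Ultrafilter ℕ) (X : ℕ → PointedMetricSpace.{u}) (a : ∀ n, X n)
    (ha : ∃ C : ℝ, ∀ n, dist (a n) (X n).pt ≤ C) : pointedUltralimit ω X :=
  letI := BoundedSeq.pseudoMetricSpace ω X
  SeparationQuotient.mk (X := BoundedSeq X) ⟨a, ha⟩

variable {ω : Ultrafilter ℕ} {X : ℕ → PointedMetricSpace.{u}}

theorem tendsto_dist_ultralimitMk {a b : ∀ n, X n}
    (ha : ∃ C : ℝ, ∀ n, dist (a n) (X n).pt ≤ C) (hb : ∃ C : ℝ, ∀ n, dist (b n) (X n).pt ≤ C) :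
    Tendsto (fun n => dist (a n) (b n)) ω
      (𝓝 (dist (ultralimitMk ω X a ha) (ultralimitMk ω X b hb))) :=
  BoundedSeq.tendsto_dist ω X ⟨a, ha⟩ ⟨b, hb⟩

theorem exists_ultralimitMk (x : pointedUltralimit ω X) :
    ∃ (a : ∀ n, X n) (ha : ∃ C : ℝ, ∀ n, dist (a n) (X n).pt ≤ C), ultralimitMk ω X a ha = x := by
  let _ := BoundedSeq.pseudoMetricSpace ω X
  obtain ⟨⟨a, ha⟩, h⟩ := SeparationQuotient.surjective_mk (X := BoundedSeq X) x
  exact ⟨a, ha, h⟩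

theorem ultralimitMk_eq {a : ∀ n, X n} {ha : ∃ C : ℝ, ∀ n, dist (a n) (X n).pt ≤ C}
    (h : ∀ n, a n = (X n).pt) : ultralimitMk ω X a ha = (pointedUltralimit ω X).pt := by
  obtain rfl : a = fun n => (X n).pt := funext h
  rfl

theorem tendsto_dist_pt_ultralimitMk {a : ∀ n, X n}
    (ha : ∃ C : ℝ, ∀ n, dist (a n) (X n).pt ≤ C) :
    Tendsto (fun n => dist (a n) (X n).pt) ω
      (𝓝 (dist (ultralimitMk ω X a ha) (pointedUltralimit ω X).pt)) :=
  tendsto_dist_ultralimitMk _ _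

/-- The geodesic of the limit consists of the classes of the sequences `γ n t`. The lengths of the
`γ n` vary with `n`, so the parameter `t` is first clamped to `[0, dist (a n) (b n)]`. -/
theorem isGeodesicSpace_ultralimit (hX : ∀ n, IsGeodesicSpace (X n)) :
    IsGeodesicSpace (pointedUltralimit ω X) := by
  intro x y
  obtain ⟨a, ha, rfl⟩ := exists_ultralimitMk x
  obtain ⟨b, hb, rfl⟩ := exists_ultralimitMk y
  choose γ h0 h1 hγ using fun n => hX n (a n) (b n)
  have hL := tendsto_dist_ultralimitMk (ω := ω) ha hb
  set L := dist (ultralimitMk ω X a ha) (ultralimitMk ω X b hb) with hLdef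
  have hL0 : 0 ≤ L := dist_nonneg
  let c : ℝ → ℝ → ℝ := fun t l => max 0 (min t l)
  have hc : ∀ t n, c t (dist (a n) (b n)) ∈ Icc 0 (dist (a n) (b n)) := fun t n =>
    ⟨le_max_left _ _, max_le dist_nonneg (min_le_right _ _)⟩
  have hbd : ∀ t, ∃ C : ℝ, ∀ n, dist (γ n (c t (dist (a n) (b n)))) (X n).pt ≤ C := by
    intro t
    obtain ⟨C, hC⟩ := ha
    obtain ⟨D, hD⟩ := hb
    refine ⟨(C + D) + C, fun n => ?_⟩
    have e1 := hγ n _ (hc t n) 0 ⟨le_rfl, dist_nonneg⟩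
    rw [h0, sub_zero, abs_of_nonneg (hc t n).1] at e1
    have e2 := dist_triangle (γ n (c t (dist (a n) (b n)))) (a n) (X n).pt
    have e3 := dist_triangle_right (a n) (b n) (X n).pt
    linarith [(hc t n).2, hC n, hD n]
  have hlim : ∀ s t, dist (ultralimitMk ω X _ (hbd s)) (ultralimitMk ω X _ (hbd t)) =
      |c s L - c t L| := by
    intro s t
    refine tendsto_nhds_unique (tendsto_dist_ultralimitMk (hbd s) (hbd t)) ?_
    simp only [hγ _ _ (hc s _) _ (hc t _)]
    have : Continuous fun l => |c s l - c t l| := by fun_prop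
    exact (this.tendsto L).comp hL
  refine ⟨fun t => ultralimitMk ω X _ (hbd t), ?_, ?_, ?_⟩
  · rw [← dist_eq_zero]
    refine tendsto_nhds_unique (tendsto_dist_ultralimitMk _ _) ?_
    have : ∀ n, c 0 (dist (a n) (b n)) = 0 := fun n => by simp [c]
    simp [this, h0]
  · rw [← dist_eq_zero]
    refine tendsto_nhds_unique (tendsto_dist_ultralimitMk _ _) ?_
    have e : ∀ n, dist (γ n (c L (dist (a n) (b n)))) (b n) =
        |c L (dist (a n) (b n)) - dist (a n) (b n)| := fun n => by
      have := hγ n _ (hc L n) _ ⟨dist_nonneg, le_rfl⟩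
      rwa [h1] at this
    simp only [e]
    have : Continuous fun l => |c L l - l| := by fun_prop
    have h2 := (this.tendsto L).comp hL
    have h3 : |c L L - L| = 0 := by simp [c, hL0]
    rwa [h3] at h2
  · intro s hs t ht
    have e : ∀ s ∈ Icc 0 L, c s L = s := fun s hs => by
      simp [c, hs.1, hs.2]
    rw [hlim, e s hs, e t ht]

/-- If domination failed for most `n`, the failing tuples would themselves define a tuple of the
ultralimit, which dominates them for most `n`. -/
theorem eventually_ballDominated_ultralimit (N : ℕ) {ε r : ℝ} (hε : 0 < ε) (hr : 0 < r) :
    ∀ᶠ n in (ω : Filter ℕ), BallDominated N ε (X n) (pointedUltralimit ω X) r := by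
  classical
  by_contra hnot
  rw [← Ultrafilter.eventually_not] at hnot
  have : ∀ n, ∃ x : Fin (N + 1) → X n, x 0 = (X n).pt ∧ (∀ i, dist (x i) (X n).pt ≤ r) ∧
      (¬ BallDominated N ε (X n) (pointedUltralimit ω X) r →
        ∀ y : Fin (N + 1) → pointedUltralimit ω X, y 0 = (pointedUltralimit ω X).pt →
          (∀ i, dist (y i) (pointedUltralimit ω X).pt ≤ r) →
            ¬ ∀ i j, dist (x i) (x j) - ε ≤ dist (y i) (y j)) := by
    intro n
    by_cases h : BallDominated N ε (X n) (pointedUltralimit ω X) r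
    · exact ⟨fun _ => (X n).pt, rfl, fun _ => by simpa using hr.le, fun h' => absurd h h'⟩
    · have h' := h
      unfold BallDominated at h'
      push Not at h'
      obtain ⟨x, h1, h2, h3⟩ := h'
      refine ⟨x, h1, h2, fun _ y hy hyr hall => ?_⟩
      obtain ⟨i, j, hij⟩ := h3 y hy hyr
      exact absurd (hall i j) (not_le.2 hij)
  choose x hx0 hxr hx using this
  have hb : ∀ i, ∃ C : ℝ, ∀ n, dist (x n i) (X n).pt ≤ C := fun i => ⟨r, fun n => hxr n i⟩
  have hev : ∀ᶠ n in (ω : Filter ℕ), ∀ i j, dist (x n i) (x n j) - ε ≤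
      dist (ultralimitMk ω X _ (hb i)) (ultralimitMk ω X _ (hb j)) := by
    rw [eventually_all]
    intro i
    rw [eventually_all]
    intro j
    filter_upwards [(tendsto_dist_ultralimitMk (ω := ω) (hb i) (hb j)).eventually
      (gt_mem_nhds (lt_add_of_pos_right _ hε))] with n hn
    linarith
  obtain ⟨n, hn, hn'⟩ := (hnot.and hev).exists
  refine hx n hn (fun i => ultralimitMk ω X _ (hb i)) (ultralimitMk_eq fun n => hx0 n) ?_ hn'
  exact fun i => le_of_tendsto' (tendsto_dist_pt_ultralimitMk (hb i)) fun n => hxr n i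

/-- Representatives of the `u i` have almost the right distances for most `n`. They may leave the
`r`-ball slightly, so they are retracted into it, and the entry `0` is replaced by the base point.
-/
theorem eventually_exists_tuple (hX : ∀ n, IsGeodesicSpace (X n)) (N : ℕ) {ε r : ℝ} (hε : 0 < ε)
    (hr : 0 < r) (u : Fin (N + 1) → pointedUltralimit ω X) (hu0 : u 0 = (pointedUltralimit ω X).pt)
    (hur : ∀ i, dist (u i) (pointedUltralimit ω X).pt ≤ r) :
    ∀ᶠ n in (ω : Filter ℕ), ∃ y : Fin (N + 1) → X n, y 0 = (X n).pt ∧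
      (∀ i, dist (y i) (X n).pt ≤ r) ∧ ∀ i j, dist (u i) (u j) - ε ≤ dist (y i) (y j) := by
  choose a ha hau using fun i => exists_ultralimitMk (u i)
  have h1 : ∀ᶠ n in (ω : Filter ℕ), ∀ i, dist (a i n) (X n).pt ≤ r + ε / 4 := by
    rw [eventually_all]
    intro i
    refine ((tendsto_dist_pt_ultralimitMk (ω := ω) (ha i)).eventually
      (gt_mem_nhds (?_ : _ < r + ε / 4))).mono fun n hn => le_of_lt hn
    rw [hau]
    linarith [hur i]
  have h2 : ∀ᶠ n in (ω : Filter ℕ), ∀ i j, dist (u i) (u j) - ε / 4 ≤ dist (a i n) (a j n) := by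
    rw [eventually_all]
    intro i
    rw [eventually_all]
    intro j
    refine ((tendsto_dist_ultralimitMk (ω := ω) (ha i) (ha j)).eventually
      (lt_mem_nhds (?_ : dist (u i) (u j) - ε / 4 < _))).mono fun n hn => le_of_lt hn
    rw [hau, hau]
    linarith
  have h3 : ∀ᶠ n in (ω : Filter ℕ), dist (a 0 n) (X n).pt < ε / 8 := by
    refine (tendsto_dist_pt_ultralimitMk (ω := ω) (ha 0)).eventually (gt_mem_nhds ?_)
    rw [hau, hu0, dist_self]
    positivity
  filter_upwards [h1, h2, h3] with n hn1 hn2 hn3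
  obtain ⟨g, hg0, hg⟩ := exists_retraction (hX n) hr.le
  have hd : ∀ i, dist (a i n) (g (a i n)) ≤ ε / 4 := fun i =>
    (hg (a i n)).2.trans (max_le (by linarith [hn1 i]) (by positivity))
  have hd' : ∀ i, dist (a i n) (if i = 0 then (X n).pt else g (a i n)) ≤ ε / 4 := by
    intro i
    split_ifs with h
    · rw [h]
      linarith
    · exact hd i
  refine ⟨fun i => if i = 0 then (X n).pt else g (a i n), by simp, fun i => ?_, fun i j => ?_⟩
  · dsimp only
    split_ifs with h
    · simpa using hr.le
    · exact (hg _).1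
  · have := dist_sub_le_of_near (a i n) (a j n) (if i = 0 then (X n).pt else g (a i n))
      (if j = 0 then (X n).pt else g (a j n))
    linarith [hn2 i j, hd' i, hd' j]

/-- A failing tuple `u n` depends on `n`, whereas `eventually_exists_tuple` treats a fixed one.
Domination only sees the matrix of distances, and these bounded matrices converge along `ω`, so one
fixed `u m` can stand in for most `u n`. -/
theorem eventually_ultralimit_ballDominated (hX : ∀ n, IsGeodesicSpace (X n)) (N : ℕ) {ε r : ℝ}
    (hε : 0 < ε) (hr : 0 < r) :
    ∀ᶠ n in (ω : Filter ℕ), BallDominated N ε (pointedUltralimit ω X) (X n) r := by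
  by_contra hnot
  rw [← Ultrafilter.eventually_not] at hnot
  have : ∀ n, ∃ u : Fin (N + 1) → pointedUltralimit ω X, u 0 = (pointedUltralimit ω X).pt ∧
      (∀ i, dist (u i) (pointedUltralimit ω X).pt ≤ r) ∧
      (¬ BallDominated N ε (pointedUltralimit ω X) (X n) r →
        ¬ ∃ y : Fin (N + 1) → X n, y 0 = (X n).pt ∧
          (∀ i, dist (y i) (X n).pt ≤ r) ∧ ∀ i j, dist (u i) (u j) - ε ≤ dist (y i) (y j)) := by
    intro n
    by_cases h : BallDominated N ε (pointedUltralimit ω X) (X n) r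
    · exact ⟨fun _ => (pointedUltralimit ω X).pt, rfl, fun _ => by simpa using hr.le,
        fun h' => absurd h h'⟩
    · have h' := h
      unfold BallDominated at h'
      push Not at h'
      obtain ⟨u, h1, h2, h3⟩ := h'
      refine ⟨u, h1, h2, fun _ => ?_⟩
      rintro ⟨y, hy, hyr, hall⟩
      obtain ⟨i, j, hij⟩ := h3 y hy hyr
      exact absurd (hall i j) (not_le.2 hij)
  choose u hu0 hur hu using this
  have hlim : ∀ i j, ∃ p : ℝ, Tendsto (fun n => dist (u n i) (u n j)) ω (𝓝 p) := by
    intro i j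
    have hmem : ∀ n, dist (u n i) (u n j) ∈ Icc (0 : ℝ) (r + r) := fun n =>
      ⟨dist_nonneg, (dist_triangle_right _ _ (pointedUltralimit ω X).pt).trans
        (add_le_add (hur n i) (hur n j))⟩
    obtain ⟨t, -, ht⟩ := isCompact_Icc.ultrafilter_le_nhds
      (ω.map fun n => dist (u n i) (u n j))
      (le_principal_iff.2 (Filter.mem_map.2 (Eventually.of_forall hmem)))
    exact ⟨t, ht⟩
  choose p hp using hlim
  have hev : ∀ᶠ n in (ω : Filter ℕ), ∀ i j, |dist (u n i) (u n j) - p i j| < ε / 4 := by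
    rw [eventually_all]
    intro i
    rw [eventually_all]
    intro j
    exact (hp i j).eventually (Metric.ball_mem_nhds _ (by positivity))
  obtain ⟨m, hm⟩ := hev.exists
  obtain ⟨n, ⟨hn1, hn2⟩, y, hy0, hyr, hy⟩ := ((hnot.and hev).and
    (eventually_exists_tuple hX N (half_pos hε) hr (u m) (hu0 m) (hur m))).exists
  refine hu n hn1 ⟨y, hy0, hyr, fun i j => ?_⟩
  have e1 := abs_lt.1 (hm i j)
  have e2 := abs_lt.1 (hn2 i j)
  linarith [hy i j, e1.1, e2.2]

end PointedMetricSpace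

open PointedMetricSpace

/-- The ultralimit of geodesic spaces, as a geodesic space. -/
def geodesicUltralimit (ω : Ultrafilter ℕ) (X : ℕ → PointedGeodesicSpace.{u}) :
    PointedGeodesicSpace.{u} where
  toPointedMetricSpace := pointedUltralimit ω fun n => (X n).toPointedMetricSpace
  geodesic := isGeodesicSpace_ultralimit fun n => (X n).geodesic

/-- Geodesic spaces converge to their ultralimit. -/
theorem tendsto_rho0_ultralimit (ω : Ultrafilter ℕ) (X : ℕ → PointedGeodesicSpace.{u}) :
    Tendsto (fun n => rho0 (X n) (geodesicUltralimit ω X)) ω (𝓝 0) := by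
  let U := (geodesicUltralimit ω X).toPointedMetricSpace
  let S : ℕ × ℕ × ℚ → Set ℕ := fun p => {n | 0 < p.2.2 →
    BallDominated p.1 (1 / ((p.2.1 : ℝ) + 1)) (X n).toPointedMetricSpace U p.2.2 ∧
    BallDominated p.1 (1 / ((p.2.1 : ℝ) + 1)) U (X n).toPointedMetricSpace p.2.2}
  -- `tendsto_rho0` requires a countably generated filter. Countably many domination conditions,
  -- with rational radii and errors `1 / (k + 1)`, generate one that is coarser than `ω`; other
  -- radii are reached from slightly smaller rational ones by `of_smaller`.
  let F : Filter ℕ := ⨅ p, 𝓟 (S p)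
  have hF : F.IsCountablyGenerated := Filter.iInf.isCountablyGenerated _
  have hωF : (ω : Filter ℕ) ≤ F := by
    refine le_iInf fun p => le_principal_iff.2 ?_
    by_cases hp : 0 < p.2.2
    · have hp' : (0 : ℝ) < p.2.2 := Rat.cast_pos.2 hp
      filter_upwards [eventually_ballDominated_ultralimit (ω := ω)
        (X := fun n => (X n).toPointedMetricSpace) p.1
        (Nat.one_div_pos_of_nat (α := ℝ) (n := p.2.1)) hp', eventually_ultralimit_ballDominated
        (ω := ω) (X := fun n => (X n).toPointedMetricSpace) (fun n => (X n).geodesic) p.1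
        (Nat.one_div_pos_of_nat (α := ℝ) (n := p.2.1)) hp'] with n h1 h2 _
      exact ⟨h1, h2⟩
    · exact Eventually.of_forall fun n h => absurd h hp
  refine Tendsto.mono_left (tendsto_rho0 fun N ε r hε hr => ?_) hωF
  obtain ⟨k, hk⟩ := exists_nat_one_div_lt (half_pos hε)
  obtain ⟨q, hq1, hq2⟩ := exists_rat_btwn (max_lt hr (sub_lt_self r (by positivity : 0 < ε / 4)))
  have hq0 : (0 : ℝ) < q := (le_max_left _ _).trans_lt hq1
  have hq3 : r - ε / 4 < q := (le_max_right _ _).trans_lt hq1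
  have : S (N, k, q) ∈ F := mem_iInf_of_mem _ (mem_principal_self _)
  filter_upwards [this] with n hn
  obtain ⟨h1, h2⟩ := hn (Rat.cast_pos.1 hq0)
  exact ⟨(h1.of_smaller (X n).geodesic hq0.le hq2.le).mono (by linarith),
    (h2.of_smaller (geodesicUltralimit ω X).geodesic hq0.le hq2.le).mono (by linarith)⟩

/-! ## Rigidity of compact spaces -/

/-- A noncontracting self-map of a compact metric space is an isometry onto the space. -/
theorem isometry_and_surjective_of_dist_le {K : Type u} [MetricSpace K] [CompactSpace K] {h : K → K}
    (hh : ∀ a b, dist a b ≤ dist (h a) (h b)) : Isometry h ∧ Function.Surjective h := by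
  have hit : ∀ (n : ℕ) (a b : K), dist a b ≤ dist (h^[n] a) (h^[n] b) := by
    intro n
    induction n with
    | zero => exact fun a b => le_rfl
    | succ n ih =>
      intro a b
      rw [Function.iterate_succ_apply', Function.iterate_succ_apply']
      exact (ih a b).trans (hh _ _)
  -- Recurrence: the orbit of `(x, y)` in `K × K` comes close to itself by compactness, and since
  -- iterates of `h` contract nothing, the near coincidence can be pulled back to the starting pair.
  have hret : ∀ (x y : K) (ε : ℝ), 0 < ε →
      ∃ p : ℕ, dist x (h^[p] (h x)) < ε ∧ dist y (h^[p] (h y)) < ε := by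
    intro x y ε hε
    obtain ⟨z, φ, hφ, hz⟩ := CompactSpace.tendsto_subseq fun n => (h^[n] x, h^[n] y)
    obtain ⟨m, hm⟩ := Metric.cauchySeq_iff.1 hz.cauchySeq ε hε
    have h1 := hm m le_rfl (m + 1) (Nat.le_succ m)
    obtain ⟨p, hp⟩ := Nat.exists_eq_add_of_lt (hφ (Nat.lt_succ_self m))
    have e : ∀ x, h^[φ (m + 1)] x = h^[φ m] (h^[p] (h x)) := fun x => by
      rw [← Function.iterate_succ_apply, ← Function.iterate_add_apply]
      congr 1
    simp only [Function.comp_apply, e, Prod.dist_eq, max_lt_iff] at h1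
    exact ⟨p, (hit _ _ _).trans_lt h1.1, (hit _ _ _).trans_lt h1.2⟩
  have hiso : Isometry h := by
    refine Isometry.of_dist_eq fun x y => le_antisymm (le_of_forall_pos_le_add fun ε hε => ?_)
      (hh x y)
    obtain ⟨p, h1, h2⟩ := hret x y (ε / 2) (half_pos hε)
    have h3 := dist_triangle4 (h^[p] (h x)) x y (h^[p] (h y))
    rw [dist_comm _ x] at h3
    linarith [hit p (h x) (h y)]
  refine ⟨hiso, fun x => ?_⟩
  have hcl : IsClosed (range h) := (isCompact_range hiso.continuous).isClosed
  rw [← mem_range, ← hcl.closure_eq, Metric.mem_closure_iff]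
  intro ε hε
  obtain ⟨p, h1, -⟩ := hret x x ε hε
  exact ⟨_, ⟨h^[p] x, (Function.iterate_succ_apply' h p x).symm.trans
    (Function.iterate_succ_apply h p x)⟩, h1⟩

namespace PointedMetricSpace

/-- The index set is directed by finite subsets because `A` may be uncountable: each pair of points
is eventually controlled. -/
theorem exists_approximation {A : PointedMetricSpace.{u}} {B : PointedMetricSpace.{v}}
    (h : ∀ (N : ℕ) (ε : ℝ), 0 < ε → Dominated N ε A B) :
    ∃ F : Finset A × ℕ → A → B, (∀ i, F i A.pt = B.pt) ∧
      ∀ (a a' : A) (ε : ℝ), 0 < ε → ∀ᶠ i in atTop, dist a a' - ε ≤ dist (F i a) (F i a') := by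
  classical
  have : ∀ i : Finset A × ℕ, ∃ f : A → B, f A.pt = B.pt ∧ ∀ a ∈ i.1, ∀ a' ∈ i.1,
      dist a a' - 1 / ((i.2 : ℝ) + 1) ≤ dist (f a) (f a') := by
    rintro ⟨T, k⟩
    obtain ⟨y, hy0, hy⟩ := (h (Nat.card ↥(insert A.pt T)) _
      (Nat.one_div_pos_of_nat (n := k))).exists_of_finite le_rfl
      (⟨A.pt, Finset.mem_insert_self _ _⟩ : ↥(insert A.pt T)) (fun a => a.1) rfl
    refine ⟨fun a => if ha : a ∈ insert A.pt T then y ⟨a, ha⟩ else B.pt, ?_, ?_⟩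
    · simp [hy0]
    · intro a ha a' ha'
      dsimp only
      rw [dif_pos (Finset.mem_insert_of_mem ha), dif_pos (Finset.mem_insert_of_mem ha')]
      exact hy ⟨a, _⟩ ⟨a', _⟩
  choose F hF0 hF using this
  refine ⟨F, hF0, fun a a' ε hε => ?_⟩
  obtain ⟨k, hk⟩ := exists_nat_one_div_lt hε
  filter_upwards [eventually_ge_atTop (({a, a'} : Finset A), k)] with i hi
  have h1 := hF i a (hi.1 (by simp)) a' (hi.1 (by simp))
  have h2 : 1 / ((i.2 : ℝ) + 1) ≤ 1 / ((k : ℝ) + 1) := Nat.one_div_le_one_div hi.2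
  linarith

/-- The pointwise limit of the approximations along an ultrafilter, which exists since `B` is
compact. -/
theorem exists_noncontracting {A : PointedMetricSpace.{u}} {B : PointedMetricSpace.{v}}
    [CompactSpace B] (h : ∀ (N : ℕ) (ε : ℝ), 0 < ε → Dominated N ε A B) :
    ∃ f : A → B, f A.pt = B.pt ∧ ∀ a a', dist a a' ≤ dist (f a) (f a') := by
  classical
  obtain ⟨F, hF0, hF⟩ := exists_approximation h
  let l : Ultrafilter (Finset A × ℕ) := Ultrafilter.of atTop
  have hl : (l : Filter (Finset A × ℕ)) ≤ atTop := Ultrafilter.of_le _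
  have hlim : ∀ a, ∃ b, Tendsto (fun i => F i a) l (𝓝 b) := fun a =>
    let ⟨b, _, hb⟩ := isCompact_univ.ultrafilter_le_nhds (l.map fun i => F i a) (by simp)
    ⟨b, hb⟩
  choose f hf using hlim
  refine ⟨f, tendsto_nhds_unique (hf A.pt) (by simp [hF0]), fun a a' => ?_⟩
  refine le_of_forall_sub_le fun ε hε => ?_
  exact ge_of_tendsto ((hf a).dist (hf a')) (hl (hF a a' ε hε))

/-- A space and a compact space that dominate each other are isometric up to completion. -/
theorem exists_isometry_denseRange {A : PointedMetricSpace.{u}} {B : PointedMetricSpace.{v}}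
    [CompactSpace B] (h : ∀ (N : ℕ) (ε : ℝ), 0 < ε → Dominated N ε A B)
    (h' : ∀ (N : ℕ) (ε : ℝ), 0 < ε → Dominated N ε B A) :
    ∃ f : A → B, f A.pt = B.pt ∧ Isometry f ∧ DenseRange f := by
  classical
  obtain ⟨f, hf0, hf⟩ := exists_noncontracting h
  obtain ⟨G, -, hG⟩ := exists_approximation h'
  let l : Ultrafilter (Finset B × ℕ) := Ultrafilter.of atTop
  have hl : (l : Filter (Finset B × ℕ)) ≤ atTop := Ultrafilter.of_le _
  have hlim : ∀ b, ∃ c, Tendsto (fun i => f (G i b)) l (𝓝 c) := fun b =>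
    let ⟨c, _, hc⟩ := isCompact_univ.ultrafilter_le_nhds (l.map fun i => f (G i b)) (by simp)
    ⟨c, hc⟩
  -- `k` is the limit of the round trips from `B` through `A` back to `B`. It is a noncontracting
  -- self-map of a compact space, hence a surjective isometry.
  choose k hk using hlim
  obtain ⟨hki, hks⟩ := isometry_and_surjective_of_dist_le (h := k) fun b b' =>
    le_of_forall_sub_le fun ε hε => ge_of_tendsto ((hk b).dist (hk b'))
      (((hG b b' ε hε).filter_mono hl).mono fun i hi => hi.trans (hf _ _))
  refine ⟨f, hf0, Isometry.of_dist_eq fun x y => le_antisymm ?_ (hf x y), fun c => ?_⟩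
  · obtain ⟨b, hb⟩ := hks (f x)
    obtain ⟨b', hb'⟩ := hks (f y)
    -- Since `f` does not contract, convergence of `f (G i b)` to `f x` forces `G i b` to converge
    -- to `x`. Distances of such limits are at least those in `B`, which bounds `dist (f x) (f y)`
    -- by `dist x y`.
    have hG' : ∀ x b, k b = f x → Tendsto (fun i => G i b) l (𝓝 x) := by
      intro x b hb
      rw [tendsto_iff_dist_tendsto_zero]
      have := tendsto_iff_dist_tendsto_zero.1 (hb ▸ hk b)
      exact squeeze_zero (fun _ => dist_nonneg) (fun i => hf _ _) this
    rw [← hb, ← hb', hki.dist_eq]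
    exact le_of_forall_sub_le fun ε hε =>
      ge_of_tendsto ((hG' x b hb).dist (hG' y b' hb')) (hl (hG b b' ε hε))
  · obtain ⟨b, rfl⟩ := hks c
    exact mem_closure_of_tendsto (hk b) (Eventually.of_forall fun i => mem_range_self _)

/-! ### From balls to whole proper spaces -/

theorem compactSpace_closedBall (Y : PointedMetricSpace.{u}) [ProperSpace Y] (r : ℝ) (hr : 0 < r) :
    CompactSpace (Y.closedBall r hr) :=
  isCompact_iff_compactSpace.1 (isCompact_closedBall Y.pt r)

theorem exists_isometry_closedBall {X : PointedMetricSpace.{u}} {Y : PointedMetricSpace.{v}}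
    [ProperSpace Y] (h : StronglyEquivalent X Y) (r : ℝ) (hr : 0 < r) :
    ∃ f : X.closedBall r hr → Y.closedBall r hr,
      f (X.closedBall r hr).pt = (Y.closedBall r hr).pt ∧ Isometry f ∧ DenseRange f := by
  have := compactSpace_closedBall Y r hr
  exact exists_isometry_denseRange
    (fun N ε hε => (dominated_closedBall_iff hr).2 ((precsim_ball_iff hr).1 (h r hr).1 N ε hε))
    fun N ε hε => (dominated_closedBall_iff hr).2 ((precsim_ball_iff hr).1 (h r hr).2 N ε hε)

/-- The isometries of the balls of radius `n + 1` need not be compatible. Each point has bounded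
images, so properness of `Y` gives a limit along an ultrafilter. -/
theorem exists_isometry_of_stronglyEquivalent {X : PointedMetricSpace.{u}}
    {Y : PointedMetricSpace.{v}} [ProperSpace Y] (h : StronglyEquivalent X Y) :
    ∃ f : X → Y, Isometry f ∧ f X.pt = Y.pt := by
  classical
  choose f hf0 hf _ using fun n : ℕ => exists_isometry_closedBall h ((n : ℝ) + 1) (by positivity)
  let F : ℕ → X → Y := fun n x => if hx : dist x X.pt ≤ (n : ℝ) + 1 then (f n ⟨x, hx⟩).1 else Y.pt
  have hF0 : ∀ n, F n X.pt = Y.pt := fun n => by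
    have : dist X.pt X.pt ≤ (n : ℝ) + 1 := by rw [dist_self]; positivity
    simp only [F, dif_pos this]
    exact congrArg Subtype.val (hf0 n)
  have hF : ∀ (n : ℕ) (x x' : X), dist x X.pt ≤ (n : ℝ) + 1 → dist x' X.pt ≤ (n : ℝ) + 1 →
      dist (F n x) (F n x') = dist x x' := by
    intro n x x' hx hx'
    simp only [F, dif_pos hx, dif_pos hx']
    exact (hf n).dist_eq ⟨x, hx⟩ ⟨x', hx'⟩
  have hev : ∀ x : X, ∀ᶠ n : ℕ in atTop, dist x X.pt ≤ (n : ℝ) + 1 := fun x => by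
    obtain ⟨m, hm⟩ := exists_nat_ge (dist x X.pt)
    filter_upwards [eventually_ge_atTop m] with n hn
    have : (m : ℝ) ≤ n := Nat.cast_le.2 hn
    linarith
  have hl : (hyperfilter ℕ : Filter ℕ) ≤ atTop := Nat.hyperfilter_le_atTop
  have hlim : ∀ x, ∃ y, Tendsto (fun n => F n x) (hyperfilter ℕ) (𝓝 y) := fun x => by
    obtain ⟨y, _, hy⟩ := (isCompact_closedBall Y.pt (dist x X.pt)).ultrafilter_le_nhds
      ((hyperfilter ℕ).map fun n => F n x) (le_principal_iff.2 (Filter.mem_map.2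
        (Filter.mem_of_superset (hl (hev x)) fun n hn => by
          have := hF n x X.pt hn (by rw [dist_self]; positivity)
          rw [hF0] at this
          exact this.le)))
    exact ⟨y, hy⟩
  choose g hg using hlim
  refine ⟨g, Isometry.of_dist_eq fun x x' => ?_, tendsto_nhds_unique (hg X.pt) (by simp [hF0])⟩
  refine tendsto_nhds_unique ((hg x).dist (hg x')) (tendsto_const_nhds.congr' ?_)
  filter_upwards [hl (hev x), hl (hev x')] with n h1 h2
  exact (hF n x x' h1 h2).symm

/-- Strongly equivalent proper spaces are isometric. -/
theorem pointedIsometric_of_stronglyEquivalent {X : PointedMetricSpace.{u}}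
    {Y : PointedMetricSpace.{v}} [ProperSpace X] [ProperSpace Y] (h : StronglyEquivalent X Y) :
    PointedIsometric X Y := by
  obtain ⟨f, hf, hf0⟩ := exists_isometry_of_stronglyEquivalent h
  obtain ⟨g, hg, hg0⟩ := exists_isometry_of_stronglyEquivalent
    (show StronglyEquivalent Y X from fun r hr => ⟨(h r hr).2, (h r hr).1⟩)
  -- `f ∘ g` preserves the distance to the base point, hence maps each compact ball of `Y` to itself
  -- isometrically and therefore onto it.
  have hsurj : Function.Surjective f := by
    intro y
    have := isCompact_iff_compactSpace.1 (isCompact_closedBall Y.pt (dist y Y.pt))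
    have hmem : ∀ z : Metric.closedBall Y.pt (dist y Y.pt),
        f (g z.1) ∈ Metric.closedBall Y.pt (dist y Y.pt) := fun z => by
      have e : dist (f (g z.1)) (f (g Y.pt)) = dist z.1 Y.pt := (hf.comp hg).dist_eq _ _
      rw [hg0, hf0] at e
      exact Metric.mem_closedBall.2 (e.trans_le z.2)
    obtain ⟨z, hz⟩ := (isometry_and_surjective_of_dist_le
      (h := fun z : Metric.closedBall Y.pt (dist y Y.pt) =>
        (⟨f (g z.1), hmem z⟩ : Metric.closedBall Y.pt (dist y Y.pt)))
      fun a b => ((hf.comp hg).dist_eq a.1 b.1).ge).2 ⟨y, Metric.mem_closedBall.2 le_rfl⟩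
    exact ⟨g z.1, congrArg Subtype.val hz⟩
  exact ⟨⟨Equiv.ofBijective f ⟨hf.injective, hsurj⟩, hf⟩, hf0⟩

/-! ## Pointed Gromov-Hausdorff convergence -/

theorem ballDominated_of_pointedGHTendsto {X : ℕ → PointedMetricSpace.{u}}
    {Y : PointedMetricSpace.{v}} (hX : ∀ n, IsGeodesicSpace (X n)) (hY : IsGeodesicSpace Y)
    (h : PointedGHTendsto X Y) (N : ℕ) {ε r : ℝ} (hε : 0 < ε) (hr : 0 < r) :
    ∀ᶠ n in atTop, BallDominated N ε (X n) Y r ∧ BallDominated N ε Y (X n) r := by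
  -- The enlarged radius makes the covered ball `B(y, r + 1)` contain the closed `r`-ball; images
  -- and preimages that overshoot the `r`-ball are retracted.
  filter_upwards [h (r + 1 + ε / 8) (by positivity) (ε / 8) (by positivity)]
  rintro n ⟨f, hf0, hf, hcov⟩
  have hb : ∀ x, dist x (X n).pt ≤ r → x ∈ Metric.ball (X n).pt (r + 1 + ε / 8) := fun x hx =>
    Metric.mem_ball.2 (by linarith)
  have hpt : (X n).pt ∈ Metric.ball (X n).pt (r + 1 + ε / 8) :=
    Metric.mem_ball_self (by positivity)
  have hfpt : ∀ x ∈ Metric.ball (X n).pt (r + 1 + ε / 8),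
      |dist (f x) Y.pt - dist x (X n).pt| < ε / 8 := fun x hx => by
    rw [← hf0]
    exact hf x hx _ hpt
  constructor
  · obtain ⟨g, hg0, hg⟩ := exists_retraction hY hr.le
    intro x hx hxr
    refine ⟨fun i => g (f (x i)), by simp only [hx, hf0, hg0], fun i => (hg _).1, fun i j => ?_⟩
    have h1 : ∀ i, dist (f (x i)) (g (f (x i))) ≤ ε / 8 := fun i => by
      refine (hg _).2.trans (max_le ?_ (by positivity))
      linarith [(abs_lt.1 (hfpt (x i) (hb _ (hxr i)))).2, hxr i]
    have h2 := (abs_lt.1 (hf (x i) (hb _ (hxr i)) (x j) (hb _ (hxr j)))).1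
    linarith [dist_sub_le_of_near (f (x i)) (f (x j)) (g (f (x i))) (g (f (x j))), h1 i, h1 j]
  · obtain ⟨g, hg0, hg⟩ := exists_retraction (hX n) hr.le
    intro y hy hyr
    have hex : ∀ i, ∃ a ∈ Metric.ball (X n).pt (r + 1 + ε / 8), dist (y i) (f a) < ε / 8 ∧
        (i = 0 → a = (X n).pt) := by
      intro i
      by_cases hi : i = 0
      · refine ⟨(X n).pt, hpt, ?_, fun _ => rfl⟩
        rw [hi, hy, hf0, dist_self]
        positivity
      · have : y i ∈ Metric.ball Y.pt (r + 1 + ε / 8 - ε / 8) :=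
          Metric.mem_ball.2 (by linarith [hyr i])
        obtain ⟨_, ⟨a, ha, rfl⟩, hd⟩ := Metric.mem_thickening_iff.1 (hcov this)
        exact ⟨a, ha, hd, fun h => absurd h hi⟩
    choose a ha hya ha0 using hex
    refine ⟨fun i => g (a i), by simp only [ha0 0 rfl, hg0], fun i => (hg _).1, fun i j => ?_⟩
    have h1 : ∀ i, dist (a i) (g (a i)) ≤ 2 * (ε / 8) := fun i => by
      refine (hg _).2.trans (max_le ?_ (by positivity))
      have := dist_triangle_left (f (a i)) Y.pt (y i)
      linarith [(abs_lt.1 (hfpt (a i) (ha i))).1, hyr i, hya i]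
    have h2 := (abs_lt.1 (hf (a i) (ha i) (a j) (ha j))).2
    linarith [dist_sub_le_of_near (a i) (a j) (g (a i)) (g (a j)), h1 i, h1 j, hya i, hya j,
      dist_sub_le_of_near (y i) (y j) (f (a i)) (f (a j))]

/-- If the ultralimit of `X n` is strongly equivalent to a proper space `Y`, then `X n` has maps to
`Y` as in the definition of pointed Gromov-Hausdorff convergence for most `n`. -/
theorem eventually_exists_map_of_ultralimit {ω : Ultrafilter ℕ} {X : ℕ → PointedMetricSpace.{u}}
    {Y : PointedMetricSpace.{v}} [ProperSpace Y]
    (h : StronglyEquivalent (pointedUltralimit ω X) Y) {r ε : ℝ} (hr : 0 < r) (hε : 0 < ε) :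
    ∀ᶠ n in (ω : Filter ℕ), ∃ f : X n → Y, f (X n).pt = Y.pt ∧
      (∀ a ∈ Metric.ball (X n).pt r, ∀ b ∈ Metric.ball (X n).pt r,
        |dist (f a) (f b) - dist a b| < ε) ∧
      Metric.ball Y.pt (r - ε) ⊆ Metric.thickening ε (f '' Metric.ball (X n).pt r) := by
  classical
  have := compactSpace_closedBall Y r hr
  obtain ⟨f, hf0, hf, hfd⟩ := exists_isometry_closedBall h r hr
  -- Both final estimates, distortion and covering, come out below `5 * δ`.
  obtain ⟨δ, hδ, rfl⟩ : ∃ δ > 0, ε = 10 * δ := ⟨ε / 10, by positivity, by ring⟩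
  -- The net is taken inside the range of `f`, so that its points lift to the ultralimit and hence
  -- to sequences `a t`.
  obtain ⟨T₀, hT₀, hT₀f, hT₀c⟩ := Metric.finite_approx_of_totallyBounded
    (isCompact_univ.totallyBounded.subset (subset_univ (range f))) δ hδ
  let T : Set (Y.closedBall r hr) := insert (Y.closedBall r hr).pt T₀
  have hTfin : Finite T := (hT₀f.insert _).to_subtype
  let t₀ : T := ⟨(Y.closedBall r hr).pt, mem_insert _ _⟩
  have hnet : ∀ x, ∃ t : T, dist (f x) t.1 < δ := fun x => by
    obtain ⟨t, ht, hx⟩ := mem_iUnion₂.1 (hT₀c (mem_range_self x))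
    exact ⟨⟨t, mem_insert_of_mem _ ht⟩, hx⟩
  have hrep : ∀ t : T, ∃ x, f x = t.1 ∧ ∃ (a : ∀ n, X n)
      (ha : ∃ C : ℝ, ∀ n, dist (a n) (X n).pt ≤ C), ultralimitMk ω X a ha = x.1 ∧
        (t = t₀ → ∀ n, a n = (X n).pt) := by
    rintro ⟨t, ht⟩
    by_cases ht0 : t = (Y.closedBall r hr).pt
    · exact ⟨_, hf0.trans ht0.symm, fun n => (X n).pt, ⟨0, fun n => by simp⟩, rfl, fun _ _ => rfl⟩
    · obtain ⟨x, rfl⟩ := hT₀ (mem_of_mem_insert_of_ne ht ht0)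
      obtain ⟨a, ha, hax⟩ := exists_ultralimitMk x.1
      exact ⟨x, rfl, a, ha, hax, fun h => absurd (congrArg Subtype.val h) ht0⟩
  choose x hx a ha hax ha0 using hrep
  have hdist : ∀ᶠ n in (ω : Filter ℕ), ∀ s t : T,
      |dist (a s n) (a t n) - dist s.1.1 t.1.1| < δ := by
    rw [eventually_all]
    intro s
    rw [eventually_all]
    intro t
    have e : dist s.1.1 t.1.1 =
        dist (ultralimitMk ω X (a s) (ha s)) (ultralimitMk ω X (a t) (ha t)) := by
      rw [hax, hax]
      have := hf.dist_eq (x s) (x t)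
      rw [hx, hx] at this
      exact this
    rw [e]
    exact (tendsto_dist_ultralimitMk (ω := ω) (ha s) (ha t)).eventually (Metric.ball_mem_nhds _ hδ)
  -- Otherwise points `z n` far from all `a t n` would define a point of the closed `r`-ball of the
  -- ultralimit that is far from the net.
  have hdense : ∀ᶠ n in (ω : Filter ℕ), ∀ z ∈ Metric.ball (X n).pt r,
      ∃ t : T, dist z (a t n) < 2 * δ := by
    by_contra hnot
    rw [← Ultrafilter.eventually_not] at hnot
    have hz : ∀ n, ∃ z : X n, dist z (X n).pt ≤ r ∧
        ((¬ ∀ z ∈ Metric.ball (X n).pt r, ∃ t : T, dist z (a t n) < 2 * δ) →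
          ∀ t : T, 2 * δ ≤ dist z (a t n)) := by
      intro n
      by_cases hn : ∀ z ∈ Metric.ball (X n).pt r, ∃ t : T, dist z (a t n) < 2 * δ
      · exact ⟨(X n).pt, by simpa using hr.le, fun h => absurd hn h⟩
      · have hn' := hn
        push Not at hn'
        obtain ⟨z, hz, hz'⟩ := hn'
        exact ⟨z, (Metric.mem_ball.1 hz).le, fun _ => hz'⟩
    choose z hzr hz using hz
    have hzb : ∃ C : ℝ, ∀ n, dist (z n) (X n).pt ≤ C := ⟨r, hzr⟩
    obtain ⟨w, hw⟩ : ∃ w : (pointedUltralimit ω X).closedBall r hr, w.1 = ultralimitMk ω X z hzb :=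
      ⟨⟨_, le_of_tendsto' (tendsto_dist_pt_ultralimitMk hzb) hzr⟩, rfl⟩
    obtain ⟨t, ht⟩ := hnet w
    rw [← hx, hf.dist_eq] at ht
    have ht' : dist (ultralimitMk ω X z hzb) (ultralimitMk ω X (a t) (ha t)) < 2 * δ := by
      rw [hax, ← hw]
      exact lt_trans ht (by linarith)
    obtain ⟨n, hn, hn'⟩ := (hnot.and ((tendsto_dist_ultralimitMk (ω := ω) hzb (ha t)).eventually
      (gt_mem_nhds ht'))).exists
    exact absurd hn' (not_lt.2 (hz n hn t))
  filter_upwards [hdist, hdense] with n hn1 hn2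
  -- The approximation sends `z` to a net point whose lift is near `z`, and the base point exactly
  -- to the base point.
  have hτ : ∀ z : X n, ∃ t : T, (z = (X n).pt → t = t₀) ∧
      (z ∈ Metric.ball (X n).pt r → dist z (a t n) < 2 * δ) := by
    intro z
    by_cases hz : z = (X n).pt
    · refine ⟨t₀, fun _ => rfl, fun _ => ?_⟩
      rw [ha0 t₀ rfl, hz, dist_self]
      positivity
    · by_cases hz' : z ∈ Metric.ball (X n).pt r
      · obtain ⟨t, ht⟩ := hn2 z hz'
        exact ⟨t, fun h => absurd h hz, fun _ => ht⟩
      · exact ⟨t₀, fun _ => rfl, fun h => absurd h hz'⟩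
  choose τ hτ0 hτ using hτ
  refine ⟨fun z => (τ z).1.1, ?_, fun b hb c hc => ?_, fun y hy => ?_⟩
  · dsimp only
    rw [hτ0 _ rfl]
    rfl
  · have h1 := abs_lt.1 (hn1 (τ b) (τ c))
    have h2 := dist_sub_le_of_near b c (a (τ b) n) (a (τ c) n)
    have h3 := dist_sub_le_of_near (a (τ b) n) (a (τ c) n) b c
    rw [dist_comm _ b, dist_comm _ c] at h3
    have h4 := hτ b hb
    have h5 := hτ c hc
    rw [abs_lt]
    constructor <;> linarith
  · rw [Metric.mem_ball] at hy
    have hyB : dist y Y.pt ≤ r := by linarith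
    obtain ⟨u, hu⟩ := Metric.denseRange_iff.1 hfd (⟨y, hyB⟩ : Metric.closedBall Y.pt r) δ hδ
    obtain ⟨t, ht⟩ := hnet u
    have h1 : dist y t.1.1 < 2 * δ := by
      have e1 : dist y (f u).1 < δ := hu
      have e2 : dist (f u).1 t.1.1 < δ := ht
      linarith [dist_triangle y (f u).1 t.1.1]
    have h2 : a t n ∈ Metric.ball (X n).pt r := by
      have e1 := (abs_lt.1 (hn1 t t₀)).2
      rw [ha0 t₀ rfl] at e1
      have e2 : dist t.1.1 t₀.1.1 ≤ dist y t.1.1 + dist y Y.pt := dist_triangle_left _ _ _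
      rw [Metric.mem_ball]
      linarith
    refine Metric.mem_thickening_iff.2 ⟨_, ⟨a t n, h2, rfl⟩, ?_⟩
    have h3 := hτ _ h2
    have h4 := (abs_lt.1 (hn1 t (τ (a t n)))).1
    have h5 := dist_triangle y t.1.1 (τ (a t n)).1.1
    dsimp only
    linarith

end PointedMetricSpace

/-! ### The compact quotient and the embedding of proper spaces -/

theorem rho0_congr {X X' Y Y' : PointedGeodesicSpace.{u}} (hX : rho0 X X' = 0)
    (hY : rho0 Y Y' = 0) : rho0 X Y = rho0 X' Y' := by
  have hX' := (rho0_comm X' X).trans hX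
  have hY' := (rho0_comm Y' Y).trans hY
  linarith [rho0_triangle X X' Y, rho0_triangle X' Y' Y, rho0_triangle X' X Y',
    rho0_triangle X Y Y']

/-- The metric induced by `ρ₀`. -/
@[reducible] def strongClassesMetric : MetricSpace StrongClasses.{u} where
  dist := Quotient.lift₂ rho0 fun _ _ _ _ hX hY =>
    rho0_congr ((rho0_eq_zero_iff _ _).2 hX) ((rho0_eq_zero_iff _ _).2 hY)
  dist_self := by
    rintro ⟨X⟩
    exact (rho0_eq_zero_iff X X).2 (strongSetoid.refl X)
  dist_comm := by
    rintro ⟨X⟩ ⟨Y⟩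
    exact rho0_comm X Y
  dist_triangle := by
    rintro ⟨X⟩ ⟨Y⟩ ⟨Z⟩
    exact rho0_triangle X Y Z
  eq_of_dist_eq_zero := by
    rintro ⟨X⟩ ⟨Y⟩ h
    exact Quotient.sound (s := strongSetoid) ((rho0_eq_zero_iff X Y).1 h)

attribute [local instance] strongClassesMetric

theorem dist_mk (X Y : PointedGeodesicSpace.{u}) :
    dist (StrongClasses.mk X) (StrongClasses.mk Y) = rho0 X Y := rfl

/-- The class of the ultralimit is a limit along an ultrafilter finer than `atTop`, hence a cluster
point of the sequence, and in a metric space a subsequence converges to it. -/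
theorem compactSpace_strongClasses : CompactSpace StrongClasses.{u} := by
  rw [← isCompact_univ_iff, isCompact_iff_isSeqCompact]
  intro x _
  choose X hX using fun n => Quotient.exists_rep (x n)
  have h : Tendsto x (hyperfilter ℕ)
      (𝓝 (StrongClasses.mk (geodesicUltralimit (hyperfilter ℕ) X))) := by
    rw [tendsto_iff_dist_tendsto_zero]
    refine (tendsto_rho0_ultralimit (hyperfilter ℕ) X).congr fun n => ?_
    rw [← hX n]
    rfl
  have hc : MapClusterPt (StrongClasses.mk (geodesicUltralimit (hyperfilter ℕ) X)) atTop x :=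
    h.mapClusterPt.mono Nat.hyperfilter_le_atTop
  obtain ⟨φ, hφ, hx⟩ := hc.tendsto_subseq
  exact ⟨_, mem_univ _, φ, hφ, hx⟩

/-- Both `Y` and the ultralimit are `rho0`-limits along `ω`, so their `rho0`-distance is zero. -/
theorem stronglyEquivalent_ultralimit {X : ℕ → PointedGeodesicSpace.{u}}
    {Y : PointedGeodesicSpace.{u}} {ω : Ultrafilter ℕ}
    (h : Tendsto (fun n => rho0 (X n) Y) ω (𝓝 0)) :
    StronglyEquivalent (pointedUltralimit ω fun n => (X n).toPointedMetricSpace)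
      Y.toPointedMetricSpace := by
  refine (rho0_eq_zero_iff (geodesicUltralimit ω X) Y).1 (le_antisymm ?_ (rho0_nonneg _ _))
  have := (tendsto_rho0_ultralimit ω X).add h
  rw [add_zero] at this
  refine ge_of_tendsto' this fun n => ?_
  rw [rho0_comm (X n)]
  exact rho0_triangle _ _ _

theorem pointedGHTendsto_iff (X : ℕ → PointedProperGeodesicSpace.{u})
    (Y : PointedProperGeodesicSpace.{u}) :
    PointedGHTendsto (fun n => (X n).toPointedMetricSpace) Y.toPointedMetricSpace ↔
      Tendsto (fun n => rho0 (X n).toPointedGeodesicSpace Y.toPointedGeodesicSpace)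
        atTop (𝓝 0) := by
  constructor
  · exact fun h => tendsto_rho0 fun N ε r hε hr =>
      ballDominated_of_pointedGHTendsto (fun n => (X n).geodesic) Y.geodesic h N hε hr
  · intro h r hr ε hε
    by_contra hnot
    rw [not_eventually, frequently_iff_neBot] at hnot
    -- An ultrafilter finer than `atTop` that contains the set of bad indices; its ultralimit is
    -- strongly equivalent to `Y`, so most indices are good.
    have hω := Ultrafilter.of_le (atTop ⊓ 𝓟 {n | ¬ ∃ f : (X n).carrier → Y.carrier,
      f (X n).pt = Y.pt ∧ (∀ a ∈ Metric.ball (X n).pt r, ∀ b ∈ Metric.ball (X n).pt r,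
        |dist (f a) (f b) - dist a b| < ε) ∧
      Metric.ball Y.pt (r - ε) ⊆ Metric.thickening ε (f '' Metric.ball (X n).pt r)})
    have := Y.proper
    have h1 := eventually_exists_map_of_ultralimit
      (stronglyEquivalent_ultralimit (h.mono_left (hω.trans inf_le_left))) hr hε
    have h2 := le_principal_iff.1 (hω.trans inf_le_right)
    obtain ⟨n, hn1, hn2⟩ := (h1.and h2).exists
    exact hn2 hn1

theorem isEmbedding_toStrongClasses : IsEmbedding ProperClasses.toStrongClasses.{u} := by
  refine ⟨⟨TopologicalSpace.ext_iff.2 fun s => ?_⟩, ?_⟩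
  · let q : PointedProperGeodesicSpace.{u} → ProperClasses.{u} :=
      Quotient.mk properIsometrySetoid.{u}
    rw [isOpen_induced_iff]
    have hq : IsOpen s ↔ ∀ Y ∈ q ⁻¹' s, ∀ X : ℕ → PointedProperGeodesicSpace.{u},
      PointedGHTendsto (fun n => (X n).toPointedMetricSpace) Y.toPointedMetricSpace →
        ∀ᶠ n in atTop, X n ∈ q ⁻¹' s := Iff.rfl
    rw [hq]
    constructor
    · intro hs
      -- A sequentially open set contains a `rho0`-ball of proper spaces about each of its members;
      -- otherwise a sequence outside it would converge to a member. The union of the corresponding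
      -- balls in the quotient induces `s`.
      have hball : ∀ Y : PointedProperGeodesicSpace.{u}, ∃ ε > 0, q Y ∈ s →
          ∀ Z : PointedProperGeodesicSpace.{u},
            rho0 Z.toPointedGeodesicSpace Y.toPointedGeodesicSpace < ε → q Z ∈ s := by
        intro Y
        by_contra! hnot
        choose hY Z hZ hZs using fun n : ℕ =>
          hnot (1 / ((n : ℝ) + 1)) Nat.one_div_pos_of_nat
        have hlim : Tendsto (fun n => rho0 (Z n).toPointedGeodesicSpace Y.toPointedGeodesicSpace)
            atTop (𝓝 0) :=
          squeeze_zero (fun _ => rho0_nonneg _ _) (fun n => (hZ n).le)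
            tendsto_one_div_add_atTop_nhds_zero_nat
        obtain ⟨n, hn⟩ := (hs Y (hY 0) Z ((pointedGHTendsto_iff Z Y).2 hlim)).exists
        exact hZs n hn
      choose ε hε hball using hball
      refine ⟨⋃ (Y : PointedProperGeodesicSpace.{u}) (_ : q Y ∈ s),
        Metric.ball (StrongClasses.mk Y.toPointedGeodesicSpace) (ε Y),
        isOpen_iUnion fun Y => isOpen_iUnion fun _ => Metric.isOpen_ball, ?_⟩
      ext z
      obtain ⟨Z, rfl⟩ := Quotient.exists_rep z
      refine mem_iUnion₂.trans ⟨?_, fun hZ => ⟨Z, hZ, Metric.mem_ball_self (hε Z)⟩⟩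
      rintro ⟨Y, hY, hZ⟩
      exact hball Y hY Z hZ
    · rintro ⟨V, hV, rfl⟩ Y hY X hX
      have hlim : Tendsto (fun n => StrongClasses.mk (X n).toPointedGeodesicSpace) atTop
          (𝓝 (StrongClasses.mk Y.toPointedGeodesicSpace)) := by
        rw [tendsto_iff_dist_tendsto_zero]
        exact (pointedGHTendsto_iff X Y).1 hX
      exact hlim.eventually (hV.mem_nhds hY)
  · rintro ⟨X⟩ ⟨Y⟩ h
    have := X.proper
    have := Y.proper
    exact Quotient.sound (s := properIsometrySetoid)
      (pointedIsometric_of_stronglyEquivalent (Quotient.exact (s := strongSetoid) h))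

end

theorem theorem2 :
    (∀ X Y : PointedGeodesicSpace.{u}, IntegrableOn (rho0Integrand X Y) (Ioi 0)) ∧
    ∃ _ : MetricSpace StrongClasses.{u},
      (∀ X Y : PointedGeodesicSpace.{u},
        dist (StrongClasses.mk X) (StrongClasses.mk Y) = rho0 X Y) ∧
      CompactSpace StrongClasses.{u} ∧
      IsEmbedding ProperClasses.toStrongClasses.{u} ∧
      (∀ (X : ℕ → PointedProperGeodesicSpace.{u}) (Y : PointedProperGeodesicSpace.{u}),
        PointedGHTendsto (fun n => (X n).toPointedMetricSpace) Y.toPointedMetricSpace ↔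
          Tendsto (fun n => rho0 (X n).toPointedGeodesicSpace Y.toPointedGeodesicSpace)
            atTop (𝓝 0)) ∧
      (∀ (X : ℕ → PointedGeodesicSpace.{u}) (Y : PointedGeodesicSpace.{u}),
        Tendsto (fun n => rho0 (X n) Y) atTop (𝓝 0) →
        ∀ ω : Ultrafilter ℕ, (ω : Filter ℕ) ≤ cofinite →
          IsGeodesicSpace (pointedUltralimit ω fun n => (X n).toPointedMetricSpace) ∧
          StronglyEquivalent (pointedUltralimit ω fun n => (X n).toPointedMetricSpace)
            Y.toPointedMetricSpace) := by
  refine ⟨integrableOn_rho0Integrand, strongClassesMetric, dist_mk, compactSpace_strongClasses,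
    isEmbedding_toStrongClasses, pointedGHTendsto_iff, fun X Y h ω hω =>
      ⟨(geodesicUltralimit ω X).geodesic, stronglyEquivalent_ultralimit ?_⟩⟩
  exact h.mono_left (hω.trans Nat.cofinite_eq_atTop.le)
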